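/- For a commutative ring $R$ and $g\ge 1$, let $\mathsf{Sp}(2g,R)$ be the group of $2g\times 2g$ matrices $X$ over $R$ with $X^tJX=J$, where $J=\begin{pmatrix}0&I\\-I&0\end{pmatrix}$, and for a group $G$ let $H_2(G)=H_2(G,\mathbb Z)$ be its second homology group with coefficients in $\mathbb Z$ with trivial action. Then for all integers $n\ge 1$ and $g\ge 2$: (i) the map $H_2(\mathsf{Sp}(2g,\mathbb Z))\to H_2(\mathsf{Sp}(2g,\mathbb Z/2^n))$ induced by reduction modulo $2^n$ is surjective, and (ii) the map $H_2(\mathsf{Sp}(2g,\mathbb Z/2^{n+1}))\to H_2(\mathsf{Sp}(2g,\mathbb Z/2^n))$ induced by reduction modulo $2^n$ is surjective. -/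

import Mathlib

/-- The symplectic group `Sp(2g, R)` of `2g × 2g` matrices over a commutative ring `R`. -/
abbrev Sp (g : ℕ) (R : Type) [CommRing R] : Type :=
  Matrix.symplecticGroup (Fin g) R

/-- The group homomorphism `Sp(2g, R) → Sp(2g, S)` that applies a ring homomorphism `R → S`
to every matrix entry. -/
def Sp.map (g : ℕ) {R S : Type} [CommRing R] [CommRing S] (f : R →+* S) : Sp g R →* Sp g S where
  toFun A := ⟨A.1.map f, SymplecticGroup.map_mem A.2 f⟩
  map_one' := Subtype.ext (Matrix.map_one f (map_zero f) (map_one f))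
  map_mul' A B := Subtype.ext (Matrix.map_mul (L := A.1) (M := B.1) (f := f))

/-- Reduction modulo `m`: the group homomorphism `Sp(2g, ℤ) → Sp(2g, ℤ/m)`. -/
def Sp.reduce (g m : ℕ) : Sp g ℤ →* Sp g (ZMod m) :=
  Sp.map g (Int.castRingHom (ZMod m))

/-- Reduction `Sp(2g, ℤ/M) → Sp(2g, ℤ/m)` for `m ∣ M`. -/
def Sp.reduceZMod (g : ℕ) {m M : ℕ} (h : m ∣ M) : Sp g (ZMod M) →* Sp g (ZMod m) :=
  Sp.map g (ZMod.castHom h (ZMod m))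

/-- The integral homology `Hᵢ(G) = Hᵢ(G, ℤ)`, with trivial action on `ℤ`. -/
noncomputable abbrev integralHomology (G : Type) [Group G] (i : ℕ) : ModuleCat ℤ :=
  groupHomology (Rep.trivial ℤ G ℤ) i

/-- The map `Hᵢ(G) → Hᵢ(H)` induced by a group homomorphism `G → H` and the identity of `ℤ`. -/
noncomputable def integralHomologyMap {G H : Type} [Group G] [Group H] (f : G →* H) (i : ℕ) :
    integralHomology G i →ₗ[ℤ] integralHomology H i :=
  (groupHomology.map (A := Rep.trivial ℤ G ℤ) (B := Rep.trivial ℤ H ℤ) f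
    (Rep.ofHom ⟨LinearMap.id, fun _ => rfl⟩) i).hom

/-! Write `G = Sp(2g, ℤ)`, `m = 2 ^ n`, and let `K` be the kernel of reduction modulo `m`. For a
surjection with kernel `K`, the five-term exact sequence shows that `H₂` is hit as soon as `K = [G,
K]`; this is proved here by hand on bar chains. Since reduction to level `2 ^ n` factors through
level `2 ^ (n + 1)`, (i) implies (ii). What remains is surjectivity of reduction
(`Sp.reduce_surjective`: transvections generate over a local ring and lift) and `K ≤ [G, K]`
(`Sp.ker_reduce_le_commutator`).

Let `q : G → Γ = G / [G, K]`, which makes `K` central. Three facts show that `q` kills `K`. (a) `q`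
kills the `m`-th power of every transvection, because `m` is even and there is a second plane
(`CentralMod.T_eq_one`). (b) Modulo a normal subgroup containing these powers, each element of `K`
moves into the `SL₂` of one plane (`exists_fixes_compl`). (c) `q` kills the level `m` part of that
`SL₂(ℤ)` (`plane_eq_one`).

For (c), the long root elements have images with parameters in the local ring `ℤ/m`. If these images
satisfy the relations in `SteinbergPair`, then the Bruhat normal form shows that `q` restricted to
`SL₂(ℤ)` depends only on the matrix modulo `m`. The one relation that needs work is multiplicativity
of the torus, that is, vanishing of the central symbols `h(u) h(v) h(uv)⁻¹`. Units modulo `2 ^ n`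
are `± 5 ^ k`, and symbols with a square entry vanish, so the crux is the symbol of `5` with itself.
It dies because `5 = 1² + 2²`: an explicit matrix turns the diagonal form `⟨1, 25⟩` into `⟨5, 5⟩`.
For short roots the torus `h_c(u) h_d(u)⁻¹` is multiplicative for free, since the symbols of two
orthogonal long roots agree and cancel; computing in that `SL₂` gives `h(5)² = h(25)`
(`ht_five_sq`). -/

/-! ### Surjectivity on second homology from `K = [G, K]` -/

section Homology

open groupHomology Finsupp
open scoped commutatorElement

variable {G Q : Type} [Group G] [Group Q]

/-- The differential of the inhomogeneous integral chains from degree two to degree one. -/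
noncomputable def barDiff (G : Type) [Group G] : (G × G →₀ ℤ) →ₗ[ℤ] (G →₀ ℤ) :=
  (d₂₁ (Rep.trivial ℤ G ℤ)).hom

lemma barDiff_single (a b : G) (n : ℤ) :
    barDiff G (single (a, b) n) = single b n - single (a * b) n + single a n :=
  d₂₁_single (A := Rep.trivial ℤ G ℤ) (a, b) n

/-- The integral two-boundaries. -/
noncomputable def barBoundaries (G : Type) [Group G] : Submodule ℤ (G × G →₀ ℤ) :=
  boundaries₂ (Rep.trivial ℤ G ℤ)

lemma single_one_right_mem (q : G) (n : ℤ) :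
    single (q, 1) n - single (1, 1) n ∈ barBoundaries G := by
  have h := single_one_fst_sub_single_one_snd_mem_boundaries₂ (A := Rep.trivial ℤ G ℤ) q 1 n
  have h2 := neg_mem h
  rw [neg_sub] at h2
  exact h2

lemma single_one_left_mem (q : G) (n : ℤ) :
    single (1, q) n - single (1, 1) n ∈ barBoundaries G := by
  have h := single_one_fst_sub_single_one_fst_mem_boundaries₂ (A := Rep.trivial ℤ G ℤ) 1 q n
  rwa [one_mul] at h

/-- The one-chains of `G` that bound a two-chain whose image in `Q` is, up to boundaries, a multiple
of the degenerate chain `(1, 1)`. -/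
def liftableChains (f : G →* Q) : Submodule ℤ (G →₀ ℤ) where
  carrier := {x | ∃ c : G × G →₀ ℤ, barDiff G c = x ∧ ∃ n : ℤ,
    mapDomain (Prod.map f f) c - single (1, 1) n ∈ barBoundaries Q}
  add_mem' := by
    rintro x y ⟨c, rfl, n, hn⟩ ⟨c', rfl, n', hn'⟩
    refine ⟨c + c', map_add _ _ _, n + n', ?_⟩
    rw [mapDomain_add, single_add, add_sub_add_comm]
    exact add_mem hn hn'
  zero_mem' := ⟨0, map_zero _, 0, by simp⟩
  smul_mem' := by
    rintro a x ⟨c, rfl, n, hn⟩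
    refine ⟨a • c, map_smul _ _ _, a * n, ?_⟩
    rw [mapDomain_smul, ← smul_eq_mul, ← smul_single, ← smul_sub]
    exact Submodule.smul_mem _ _ hn

variable {f : G →* Q}

lemma barDiff_mem_liftableChains {a b : G} (h : f a = 1 ∨ f b = 1) :
    barDiff G (single (a, b) 1) ∈ liftableChains f := by
  refine ⟨_, rfl, 1, ?_⟩
  rw [mapDomain_single, Prod.map_apply]
  rcases h with h | h <;> rw [h]
  · exact single_one_left_mem _ _
  · exact single_one_right_mem _ _

/-- The chain is the boundary of `(⁅g, k⁆, k * g) - (g, k) + (k, g)`, and each of these pairs has an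
entry in the kernel, so its image in `Q` is degenerate. -/
lemma single_commutator_mem {g k : G} (hk : k ∈ f.ker) :
    (single ⁅g, k⁆ 1 : G →₀ ℤ) ∈ liftableChains f := by
  have hk' : f k = 1 := hk
  have h1 := barDiff_mem_liftableChains (f := f) (a := ⁅g, k⁆) (b := k * g)
    (Or.inl (by simp [commutatorElement_def, hk']))
  have h2 := barDiff_mem_liftableChains (f := f) (a := g) (b := k) (Or.inr hk')
  have h3 := barDiff_mem_liftableChains (f := f) (a := k) (b := g) (Or.inl hk')
  have h := add_mem (sub_mem h1 h2) h3
  rw [barDiff_single, barDiff_single, barDiff_single] at h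
  have e : ⁅g, k⁆ * (k * g) = g * k := by rw [commutatorElement_def]; group
  rw [e] at h
  convert h using 1
  abel

/-- The kernel elements whose one-chain is liftable form a subgroup, and this subgroup contains the
generators `⁅g, k⁆` of `[G, K]`. -/
lemma single_mem_liftableChains (hK : f.ker ≤ ⁅(⊤ : Subgroup G), f.ker⁆) {k : G}
    (hk : k ∈ f.ker) : (single k 1 : G →₀ ℤ) ∈ liftableChains f := by
  let H : Subgroup G :=
    { carrier := {k | f k = 1 ∧ (single k 1 : G →₀ ℤ) ∈ liftableChains f}
      mul_mem' := by
        rintro a b ⟨ha, ha'⟩ ⟨hb, hb'⟩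
        refine ⟨by simp [ha, hb], ?_⟩
        have h := sub_mem (add_mem ha' hb') (barDiff_mem_liftableChains (f := f) (b := b) (Or.inl ha))
        rw [barDiff_single] at h
        convert h using 1
        abel
      one_mem' := by
        refine ⟨map_one f, ?_⟩
        have h := barDiff_mem_liftableChains (f := f) (a := 1) (b := 1) (Or.inl (map_one f))
        simpa [barDiff_single] using h
      inv_mem' := by
        rintro a ⟨ha, ha'⟩
        refine ⟨by simp [ha], ?_⟩
        have h1 := barDiff_mem_liftableChains (f := f) (a := 1) (b := 1) (Or.inl (map_one f))
        have h2 := barDiff_mem_liftableChains (f := f) (b := a⁻¹) (Or.inl ha)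
        rw [barDiff_single] at h1 h2
        have h := add_mem (sub_mem h2 ha') h1
        rw [mul_inv_cancel, one_mul] at h
        convert h using 1
        abel }
  have : ⁅(⊤ : Subgroup G), f.ker⁆ ≤ H := Subgroup.commutator_le.2 fun g _ k hk =>
    ⟨by simp [commutatorElement_def, MonoidHom.mem_ker.1 hk], single_commutator_mem hk⟩
  exact (this (hK hk)).2

lemma single_sub_single_mem (hK : f.ker ≤ ⁅(⊤ : Subgroup G), f.ker⁆) {a b : G} (h : f a = f b)
    (n : ℤ) : (single a n - single b n : G →₀ ℤ) ∈ liftableChains f := by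
  have hk : a⁻¹ * b ∈ f.ker := by simp [MonoidHom.mem_ker, h]
  have h1 := barDiff_mem_liftableChains (f := f) (a := a) (Or.inr (MonoidHom.mem_ker.1 hk))
  rw [barDiff_single, mul_inv_cancel_left] at h1
  have h2 := (liftableChains f).smul_mem n (sub_mem h1 (single_mem_liftableChains hK hk))
  convert h2 using 1
  simp only [smul_sub, smul_add, smul_single, smul_eq_mul, mul_one]
  abel

/-- A chain in the kernel of the induced map on one-chains is liftable. -/
lemma mem_liftableChains_of_mapDomain_eq_zero (hK : f.ker ≤ ⁅(⊤ : Subgroup G), f.ker⁆)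
    (hf : Function.Surjective f) (x : G →₀ ℤ) (hx : mapDomain f x = 0) :
    x ∈ liftableChains f := by
  -- Modulo liftable chains every element may be replaced by the chosen representative of its fibre,
  -- so a chain is determined by its image.
  have key : ∀ x : G →₀ ℤ,
      x - mapDomain (Function.surjInv hf) (mapDomain f x) ∈ liftableChains f := by
    intro x
    induction x using Finsupp.induction_linear with
    | zero => simp
    | add x y hx hy => rw [mapDomain_add, mapDomain_add, add_sub_add_comm]; exact add_mem hx hy
    | single a n =>
      rw [mapDomain_single, mapDomain_single]
      exact single_sub_single_mem hK (Function.surjInv_eq hf _).symm n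
  simpa [hx] using key x

lemma barDiff_mapDomain (f : G →* Q) (c : G × G →₀ ℤ) :
    barDiff Q (mapDomain (Prod.map f f) c) = mapDomain f (barDiff G c) := by
  induction c using Finsupp.induction_linear with
  | zero => simp
  | add x y hx hy => rw [mapDomain_add, map_add, map_add, mapDomain_add, hx, hy]
  | single a n =>
    obtain ⟨a, b⟩ := a
    rw [mapDomain_single, Prod.map_apply, barDiff_single, barDiff_single, sub_eq_add_neg,
      sub_eq_add_neg, mapDomain_add, mapDomain_add, ← single_neg, ← single_neg,
      mapDomain_single, mapDomain_single, mapDomain_single, map_mul]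

/-- Lift the cycle to any chain `c₀`. Its boundary maps to zero, so it also bounds a chain `c` whose
image is a boundary; then `c₀ - c` is a cycle with the right image. -/
lemma exists_cycle_lift (hK : f.ker ≤ ⁅(⊤ : Subgroup G), f.ker⁆)
    (hf : Function.Surjective f) (z : Q × Q →₀ ℤ) (hz : barDiff Q z = 0) :
    ∃ c : G × G →₀ ℤ, barDiff G c = 0 ∧
      mapDomain (Prod.map f f) c - z ∈ barBoundaries Q := by
  have hf2 : Function.Surjective (Prod.map f f) := hf.prodMap hf
  obtain ⟨c₀, rfl⟩ := mapDomain_surjective hf2 z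
  obtain ⟨c, hc, n, hn⟩ := mem_liftableChains_of_mapDomain_eq_zero hK hf (barDiff G c₀)
    (by rw [← barDiff_mapDomain, hz])
  have hd : barDiff Q (mapDomain (Prod.map f f) c - single (1, 1) n) = 0 :=
    (mem_cycles₂_of_mem_boundaries₂ (A := Rep.trivial ℤ Q ℤ) _ hn :)
  -- The degenerate chain `(1, 1)` has boundary the one-chain at `1`, which is nonzero, so comparing
  -- boundaries removes the degenerate correction.
  have hn0 : n = 0 := by
    rw [map_sub, barDiff_mapDomain, hc, ← barDiff_mapDomain, hz, barDiff_single, zero_sub,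
      neg_eq_zero] at hd
    simpa using hd
  refine ⟨c₀ - c, by rw [map_sub, hc, sub_self], ?_⟩
  rw [hn0, single_zero, sub_zero] at hn
  have : mapDomain (Prod.map f f) (c₀ - c) =
      mapDomain (Prod.map f f) c₀ - mapDomain (Prod.map f f) c :=
    map_sub (Finsupp.mapDomain.addMonoidHom _) c₀ c
  rw [this]
  simpa using hn

/-- If the kernel `K` of a surjection `f : G → Q` satisfies `K = [G, K]`, then `f` induces a
surjection on second homology. -/
theorem integralHomologyMap_two_surjective (hK : f.ker ≤ ⁅(⊤ : Subgroup G), f.ker⁆)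
    (hf : Function.Surjective f) : Function.Surjective (integralHomologyMap f 2) := by
  intro y
  induction y using H2_induction_on with
  | h z =>
    obtain ⟨c, hc, hcz⟩ := exists_cycle_lift hK hf z.1 z.2
    refine ⟨H2π (Rep.trivial ℤ G ℤ) ⟨c, hc⟩, ?_⟩
    have h1 := H2π_comp_map_apply (A := Rep.trivial ℤ G ℤ) (B := Rep.trivial ℤ Q ℤ) f
      (Rep.ofHom ⟨LinearMap.id, fun _ => rfl⟩) ⟨c, hc⟩
    refine h1.trans ?_
    rw [H2π_eq_iff, coe_mapCycles₂]
    have e : mapRange.linearMap (LinearMap.id : ℤ →ₗ[ℤ] ℤ) (mapDomain (Prod.map f f) c) =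
        mapDomain (Prod.map f f) c := by simp
    rw [← e] at hcz
    exact hcz

lemma integralHomologyMap_comp {H : Type} [Group H] (f : G →* Q) (f' : Q →* H) (i : ℕ) :
    integralHomologyMap (f'.comp f) i = integralHomologyMap f' i ∘ₗ integralHomologyMap f i := by
  have := groupHomology.map_comp (A := Rep.trivial ℤ G ℤ) (B := Rep.trivial ℤ Q ℤ)
    (C := Rep.trivial ℤ H ℤ) f f' (Rep.ofHom ⟨LinearMap.id, fun _ => rfl⟩)
    (Rep.ofHom ⟨LinearMap.id, fun _ => rfl⟩) i
  exact congrArg ModuleCat.Hom.hom this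

end Homology

/-! ### The standard alternating form -/

open Matrix

section Form

variable {g : ℕ} {R : Type} [CommRing R]

/-- The standard alternating form on `R^{2g}`. -/
def sform (x y : Fin g ⊕ Fin g → R) : R :=
  ∑ i, (x (.inl i) * y (.inr i) - x (.inr i) * y (.inl i))

@[simp] lemma sform_add_left (x y z : Fin g ⊕ Fin g → R) :
    sform (x + y) z = sform x z + sform y z := by
  simp only [sform, ← Finset.sum_add_distrib, Pi.add_apply]
  exact Finset.sum_congr rfl fun i _ => by ring

@[simp] lemma sform_add_right (x y z : Fin g ⊕ Fin g → R) :
    sform x (y + z) = sform x y + sform x z := by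
  simp only [sform, ← Finset.sum_add_distrib, Pi.add_apply]
  exact Finset.sum_congr rfl fun i _ => by ring

@[simp] lemma sform_smul_left (k : R) (x y : Fin g ⊕ Fin g → R) :
    sform (k • x) y = k * sform x y := by
  simp only [sform, Finset.mul_sum, Pi.smul_apply, smul_eq_mul]
  exact Finset.sum_congr rfl fun i _ => by ring

@[simp] lemma sform_smul_right (k : R) (x y : Fin g ⊕ Fin g → R) :
    sform x (k • y) = k * sform x y := by
  simp only [sform, Finset.mul_sum, Pi.smul_apply, smul_eq_mul]
  exact Finset.sum_congr rfl fun i _ => by ring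

@[simp] lemma sform_neg_left (x y : Fin g ⊕ Fin g → R) : sform (-x) y = -sform x y := by
  simpa using sform_smul_left (-1) x y

@[simp] lemma sform_neg_right (x y : Fin g ⊕ Fin g → R) : sform x (-y) = -sform x y := by
  simpa using sform_smul_right (-1) x y

@[simp] lemma sform_sub_left (x y z : Fin g ⊕ Fin g → R) :
    sform (x - y) z = sform x z - sform y z := by
  simp [sub_eq_add_neg]

@[simp] lemma sform_sub_right (x y z : Fin g ⊕ Fin g → R) :
    sform x (y - z) = sform x y - sform x z := by
  simp [sub_eq_add_neg]

@[simp] lemma sform_zero_left (x : Fin g ⊕ Fin g → R) : sform 0 x = 0 := by simp [sform]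

@[simp] lemma sform_zero_right (x : Fin g ⊕ Fin g → R) : sform x 0 = 0 := by simp [sform]

@[simp] lemma sform_self (x : Fin g ⊕ Fin g → R) : sform x x = 0 :=
  Finset.sum_eq_zero fun i _ => by ring

lemma sform_swap (x y : Fin g ⊕ Fin g → R) : sform x y = -sform y x := by
  simp only [sform, ← Finset.sum_neg_distrib]
  exact Finset.sum_congr rfl fun i _ => by ring

/-- The basis vector `e_i`. -/
def ev (R : Type) [CommRing R] (i : Fin g) : Fin g ⊕ Fin g → R := Pi.single (.inl i) 1

/-- The basis vector `f_i`, dual to `e_i`. -/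
def fv (R : Type) [CommRing R] (i : Fin g) : Fin g ⊕ Fin g → R := Pi.single (.inr i) 1

lemma sform_ev_left (i : Fin g) (x : Fin g ⊕ Fin g → R) : sform (ev R i) x = x (.inr i) := by
  simp [sform, ev, Pi.single_apply]

lemma sform_fv_left (i : Fin g) (x : Fin g ⊕ Fin g → R) : sform (fv R i) x = -x (.inl i) := by
  simp [sform, fv, Pi.single_apply]

lemma sform_ev_right (i : Fin g) (x : Fin g ⊕ Fin g → R) : sform x (ev R i) = -x (.inr i) := by
  rw [sform_swap, sform_ev_left]

lemma sform_fv_right (i : Fin g) (x : Fin g ⊕ Fin g → R) : sform x (fv R i) = x (.inl i) := by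
  rw [sform_swap, sform_fv_left, neg_neg]

@[simp] lemma sform_ev_ev (i j : Fin g) : sform (ev R i) (ev R j) = 0 := by
  rw [sform_ev_left]; simp [ev]

@[simp] lemma sform_fv_fv (i j : Fin g) : sform (fv R i) (fv R j) = 0 := by
  rw [sform_fv_left]; simp [fv]

@[simp] lemma sform_ev_fv (i : Fin g) : sform (ev R i) (fv R i) = 1 := by
  simp [sform_ev_left, fv]

@[simp] lemma sform_fv_ev (i : Fin g) : sform (fv R i) (ev R i) = -1 := by
  simp [sform_fv_left, ev]

lemma sform_ev_fv_ne {i j : Fin g} (h : i ≠ j) : sform (ev R i) (fv R j) = 0 := by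
  simp [sform_ev_left, fv, h]

lemma sform_fv_ev_ne {i j : Fin g} (h : i ≠ j) : sform (fv R i) (ev R j) = 0 := by
  simp [sform_fv_left, ev, h]

lemma sform_map {S : Type} [CommRing S] (φ : R →+* S) (x y : Fin g ⊕ Fin g → R) :
    sform (φ ∘ x) (φ ∘ y) = φ (sform x y) := by
  simp [sform, map_sum]

lemma sform_eq_dotProduct (x y : Fin g ⊕ Fin g → R) :
    sform x y = -(x ⬝ᵥ (J (Fin g) R *ᵥ y)) := by
  simp [sform, J, dotProduct, fromBlocks_mulVec, Fintype.sum_sum_type, neg_mulVec,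
    Finset.sum_add_distrib, sub_eq_add_neg, add_comm]

lemma eq_sum_ev_fv (x : Fin g ⊕ Fin g → R) :
    x = ∑ i, (x (.inl i) • ev R i + x (.inr i) • fv R i) := by
  funext j
  rcases j with j | j <;> simp [Finset.sum_apply, ev, fv, Pi.single_apply]

end Form

/-! ### Transvections and short root elements -/

namespace Sp

variable {g : ℕ} {R : Type} [CommRing R]

lemma smul_def (A : Sp g R) (x : Fin g ⊕ Fin g → R) : A • x = A.1 *ᵥ x := rfl

@[simp] lemma sform_smul_smul (A : Sp g R) (x y : Fin g ⊕ Fin g → R) :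
    sform (A • x) (A • y) = sform x y := by
  have h := SymplecticGroup.mem_iff'.1 A.2
  rw [sform_eq_dotProduct, sform_eq_dotProduct, smul_def, smul_def, mulVec_mulVec,
    dotProduct_mulVec, vecMul_mulVec, ← dotProduct_mulVec, ← Matrix.mul_assoc, h]

lemma sform_smul_left' (A : Sp g R) (x y : Fin g ⊕ Fin g → R) :
    sform (A • x) y = sform x (A⁻¹ • y) := by
  rw [← sform_smul_smul A x, smul_inv_smul]

lemma ext_smul {A B : Sp g R} (h : ∀ x : Fin g ⊕ Fin g → R, A • x = B • x) : A = B :=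
  Subtype.ext (Matrix.ext_of_mulVec_single fun i => h (Pi.single i 1))

lemma ext_basis {A B : Sp g R} (he : ∀ i : Fin g, A • ev R i = B • ev R i)
    (hf : ∀ i : Fin g, A • fv R i = B • fv R i) : A = B :=
  ext_smul fun x => by
    rw [eq_sum_ev_fv x]
    have hc (C : Sp g R) (k : R) (y : Fin g ⊕ Fin g → R) : C • k • y = k • C • y :=
      smul_comm C k y
    simp only [Finset.smul_sum, smul_add, hc, he, hf]

/-- The symplectic matrix of a form-preserving linear map. -/
def ofLinear (φ : (Fin g ⊕ Fin g → R) →ₗ[R] (Fin g ⊕ Fin g → R))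
    (h : ∀ x y, sform (φ x) (φ y) = sform x y) : Sp g R :=
  ⟨LinearMap.toMatrix' φ, by
    rw [SymplecticGroup.mem_iff']
    apply Matrix.ext_of_mulVec_single
    intro i
    have key : ∀ x : Fin g ⊕ Fin g → R,
        x ⬝ᵥ (((LinearMap.toMatrix' φ)ᵀ * J (Fin g) R * LinearMap.toMatrix' φ) *ᵥ
          Pi.single i 1) = x ⬝ᵥ (J (Fin g) R *ᵥ Pi.single i 1) := by
      intro x
      have := h x (Pi.single i 1)
      rw [sform_eq_dotProduct, sform_eq_dotProduct, neg_inj, ← LinearMap.toMatrix'_mulVec,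
        ← LinearMap.toMatrix'_mulVec] at this
      rw [← this, ← mulVec_mulVec, ← mulVec_mulVec, dotProduct_mulVec, vecMul_transpose]
    funext j
    simpa using key (Pi.single j 1)⟩

@[simp] lemma ofLinear_smul (φ : (Fin g ⊕ Fin g → R) →ₗ[R] (Fin g ⊕ Fin g → R))
    (h : ∀ x y, sform (φ x) (φ y) = sform x y) (x : Fin g ⊕ Fin g → R) :
    ofLinear φ h • x = φ x :=
  LinearMap.toMatrix'_mulVec φ x

/-- The transvection `x ↦ x + k ω(v, x) v`. -/
def T (v : Fin g ⊕ Fin g → R) (k : R) : Sp g R :=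
  ofLinear
    { toFun := fun x => x + (k * sform v x) • v
      map_add' := fun x y => by simp only [sform_add_right]; module
      map_smul' := fun c x => by simp only [sform_smul_right, RingHom.id_apply]; module }
    (fun x y => by simp [sform_swap x v]; ring)

lemma T_smul (v : Fin g ⊕ Fin g → R) (k : R) (x : Fin g ⊕ Fin g → R) :
    T v k • x = x + (k * sform v x) • v := ofLinear_smul _ _ _

lemma T_smul_of_sform_eq_zero {v x : Fin g ⊕ Fin g → R} (h : sform v x = 0) (k : R) :
    T v k • x = x := by simp [T_smul, h]

lemma T_add (v : Fin g ⊕ Fin g → R) (k l : R) : T v (k + l) = T v k * T v l :=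
  ext_smul fun x => by
    simp only [mul_smul, T_smul, sform_add_right, sform_smul_right, sform_self]; module

@[simp] lemma T_zero (v : Fin g ⊕ Fin g → R) : T v 0 = 1 :=
  ext_smul fun x => by simp [T_smul]

lemma T_neg (v : Fin g ⊕ Fin g → R) (k : R) : T v (-k) = (T v k)⁻¹ :=
  eq_inv_of_mul_eq_one_left (by rw [← T_add]; simp)

lemma T_smul_vec (c : R) (v : Fin g ⊕ Fin g → R) (k : R) : T (c • v) k = T v (c ^ 2 * k) :=
  ext_smul fun x => by simp only [T_smul, sform_smul_left]; module

lemma T_neg_vec (v : Fin g ⊕ Fin g → R) (k : R) : T (-v) k = T v k := by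
  simpa using T_smul_vec (-1) v k

lemma conj_T (A : Sp g R) (v : Fin g ⊕ Fin g → R) (k : R) :
    A * T v k * A⁻¹ = T (A • v) k :=
  ext_smul fun x => by
    rw [mul_smul, mul_smul, T_smul, T_smul, smul_add, smul_inv_smul,
      smul_comm A (_ : R) v, sform_smul_left']

lemma T_zpow (v : Fin g ⊕ Fin g → R) (k : R) (n : ℤ) : T v k ^ n = T v (n * k) := by
  induction n with
  | zero => simp
  | succ n ih => rw [_root_.zpow_add_one, ih, ← T_add]; congr 1; push_cast; ring
  | pred n ih => rw [_root_.zpow_sub_one, ih, ← T_neg, ← T_add]; congr 1; push_cast; ring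

lemma T_commute {u v : Fin g ⊕ Fin g → R} (h : sform u v = 0) (k l : R) :
    Commute (T u k) (T v l) := by
  rw [Commute, SemiconjBy, ← mul_inv_eq_iff_eq_mul, conj_T, T_smul_of_sform_eq_zero h]

/-- The map `x ↦ x + k (ω(u, x) v + ω(v, x) u)` for `ω(u, v) = 0`. -/
def S (u v : Fin g ⊕ Fin g → R) (k : R) : Sp g R := T (u + v) k * T u (-k) * T v (-k)

lemma S_smul {u v : Fin g ⊕ Fin g → R} (h : sform u v = 0) (k : R) (x : Fin g ⊕ Fin g → R) :
    S u v k • x = x + (k * sform u x) • v + (k * sform v x) • u := by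
  have h' : sform v u = 0 := by rw [sform_swap, h, neg_zero]
  simp only [S, mul_smul, T_smul, sform_add_right, sform_smul_right, sform_add_left, sform_self,
    h, h']
  module

lemma S_add {u v : Fin g ⊕ Fin g → R} (h : sform u v = 0) (k l : R) :
    S u v (k + l) = S u v k * S u v l := by
  have h' : sform v u = 0 := by rw [sform_swap, h, neg_zero]
  refine ext_smul fun x => ?_
  simp only [mul_smul, S_smul h, sform_add_right, sform_smul_right, sform_self, h, h']
  module

lemma S_zero (u v : Fin g ⊕ Fin g → R) : S u v 0 = 1 := by simp [S]

lemma S_neg {u v : Fin g ⊕ Fin g → R} (h : sform u v = 0) (k : R) :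
    S u v (-k) = (S u v k)⁻¹ :=
  eq_inv_of_mul_eq_one_left (by rw [← S_add h]; simp [S_zero])

lemma conj_S (A : Sp g R) (u v : Fin g ⊕ Fin g → R) (k : R) :
    A * S u v k * A⁻¹ = S (A • u) (A • v) k := by
  rw [S, S, ← smul_add, ← conj_T, ← conj_T, ← conj_T]; group

/-- A transvection is quadratic in its vector and `S` is the polarization. This identity is the
source of the relations between long and short root elements. -/
lemma T_add_vec {u v : Fin g ⊕ Fin g → R} (h : sform u v = 0) (k : R) :
    T (u + v) k = T u k * T v k * S u v k := by
  have h' : sform v u = 0 := by rw [sform_swap, h, neg_zero]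
  refine ext_smul fun x => ?_
  simp only [mul_smul, S_smul h, T_smul, sform_add_right, sform_smul_right, sform_self,
    sform_add_left, h, h']
  module

lemma S_comm (u v : Fin g ⊕ Fin g → R) (h : sform u v = 0) (k : R) : S u v k = S v u k := by
  have h' : sform v u = 0 := by rw [sform_swap, h, neg_zero]
  refine ext_smul fun x => ?_
  simp only [S_smul h, S_smul h']
  module

lemma S_smul_left_vec {u v : Fin g ⊕ Fin g → R} (h : sform u v = 0) (c k : R) :
    S (c • u) v k = S u v (c * k) := by
  refine ext_smul fun x => ?_
  rw [S_smul (by simp [h]), S_smul h]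
  simp only [sform_smul_left]
  module

lemma S_smul_right_vec {u v : Fin g ⊕ Fin g → R} (h : sform u v = 0) (c k : R) :
    S u (c • v) k = S u v (c * k) := by
  refine ext_smul fun x => ?_
  rw [S_smul (by simp [h]), S_smul h]
  simp only [sform_smul_left]
  module

lemma S_neg_right_vec {u v : Fin g ⊕ Fin g → R} (h : sform u v = 0) (k : R) :
    S u (-v) k = S u v (-k) := by
  simpa using S_smul_right_vec h (-1) k

lemma S_add_right_vec {u v w : Fin g ⊕ Fin g → R} (hv : sform u v = 0) (hw : sform u w = 0)
    (hvw : sform v w = 0) (k : R) : S u (v + w) k = S u v k * S u w k := by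
  have hv' : sform v u = 0 := by rw [sform_swap, hv, neg_zero]
  refine ext_smul fun x => ?_
  rw [mul_smul, S_smul (by simp [hv, hw]), S_smul hv, S_smul hw]
  simp only [sform_add_right, sform_smul_right, sform_self, sform_add_left, hw, hvw, hv']
  module

lemma T_commute_S {u v w : Fin g ⊕ Fin g → R} (hu : sform w u = 0) (hv : sform w v = 0)
    (k l : R) : Commute (T w k) (S u v l) := by
  have := T_commute (u := w) (v := u + v) (by simp [hu, hv]) k l
  exact ((this.mul_right (T_commute hu _ _)).mul_right (T_commute hv _ _))

lemma map_smul_comp {S : Type} [CommRing S] (φ : R →+* S) (A : Sp g R)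
    (x : Fin g ⊕ Fin g → R) : Sp.map g φ A • (φ ∘ x) = φ ∘ (A • x) :=
  (funext (RingHom.map_mulVec φ A.1 x)).symm

lemma map_T {S : Type} [CommRing S] (φ : R →+* S) (v : Fin g ⊕ Fin g → R) (k : R) :
    Sp.map g φ (T v k) = T (φ ∘ v) (φ k) := by
  have h : ∀ x : Fin g ⊕ Fin g → R, Sp.map g φ (T v k) • (φ ∘ x) = T (φ ∘ v) (φ k) • (φ ∘ x) := by
    intro x
    rw [map_smul_comp, T_smul, T_smul, sform_map]
    funext i
    simp
  -- The standard basis over `S` comes from `R`, so comparing on images of vectors suffices even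
  -- when `φ` is not surjective.
  have he : ∀ i : Fin g, ev S i = φ ∘ ev R i := fun i => by
    funext j; simp [ev, Pi.single_apply, apply_ite φ]
  have hf : ∀ i : Fin g, fv S i = φ ∘ fv R i := fun i => by
    funext j; simp [fv, Pi.single_apply, apply_ite φ]
  exact Sp.ext_basis (fun i => by rw [he, h]) (fun i => by rw [hf, h])

end Sp

/-! ### Bruhat normal form for `SL₂` over a local ring -/

section NormalForm

variable {R Γ : Type} [CommRing R] [Group Γ]

/-- The upper elementary matrix. -/
def upperE (t : R) : SpecialLinearGroup (Fin 2) R := ⟨!![1, t; 0, 1], by simp [det_fin_two]⟩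

/-- The lower elementary matrix. -/
def lowerE (t : R) : SpecialLinearGroup (Fin 2) R := ⟨!![1, 0; t, 1], by simp [det_fin_two]⟩

/-- The Weyl element. -/
def weylE : SpecialLinearGroup (Fin 2) R := ⟨!![0, 1; -1, 0], by simp [det_fin_two]⟩

/-- The diagonal matrix with entries `u, u⁻¹`. -/
def diagE (u : Rˣ) : SpecialLinearGroup (Fin 2) R :=
  ⟨!![(u : R), 0; 0, ((u⁻¹ : Rˣ) : R)], by simp [det_fin_two]⟩

/-- Elements of `Γ` that satisfy the defining relations of `SL₂` over a local ring. -/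
structure SteinbergPair (x y : R → Γ) (h : Rˣ → Γ) (w : Γ) : Prop where
  x_add : ∀ s t, x (s + t) = x s * x t
  y_add : ∀ s t, y (s + t) = y s * y t
  h_mul : ∀ u v, h (u * v) = h u * h v
  h_x : ∀ u t, h u * x t = x (u ^ 2 * t) * h u
  h_y : ∀ u t, h u * y t = y (((u⁻¹ : Rˣ) : R) ^ 2 * t) * h u
  w_x : ∀ t, w * x t = y (-t) * w
  w_y : ∀ t, w * y t = x (-t) * w
  w_unit : ∀ u : Rˣ, x u * y (-((u⁻¹ : Rˣ) : R)) * x u = h u * w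

namespace SteinbergPair

variable {x y : R → Γ} {h : Rˣ → Γ} {w : Γ} (P : SteinbergPair x y h w)
include P

lemma x_zero : x 0 = 1 := by simpa using P.x_add 0 0

lemma y_zero : y 0 = 1 := by simpa using P.y_add 0 0

lemma x_neg (t : R) : x (-t) = (x t)⁻¹ :=
  eq_inv_of_mul_eq_one_left (by rw [← P.x_add]; simp [P.x_zero])

lemma y_neg (t : R) : y (-t) = (y t)⁻¹ :=
  eq_inv_of_mul_eq_one_left (by rw [← P.y_add]; simp [P.y_zero])

lemma h_one : h 1 = 1 := by simpa using P.h_mul 1 1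

/-- Compare `w_unit` at `1` and at `-1`: the second word is the inverse of the first, so `w⁻¹ = h
(-1) * w`, and `h (-1)` is an involution. -/
lemma w_sq : w * w = h (-1) := by
  have h1 := P.w_unit 1
  have h2 := P.w_unit (-1)
  simp only [P.h_one, Units.val_one, inv_one, one_mul] at h1
  simp only [inv_neg, inv_one, Units.val_neg, Units.val_one, neg_neg, P.x_neg] at h2
  have h3 : w⁻¹ = h (-1) * w := by rw [← h2, ← h1, P.y_neg]; group
  have h4 : h (-1) * h (-1) = 1 := by rw [← P.h_mul]; simp [P.h_one]
  have h5 : h (-1) * (w * w) = 1 := by rw [← mul_assoc, ← h3]; simp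
  exact mul_left_cancel (h5.trans h4.symm)

lemma h_neg (u : Rˣ) : h (-u) = h u * (w * w) := by
  rw [P.w_sq, ← P.h_mul, mul_neg_one]

/-- Rewrites an element of the cell `x w` in the form `y h x`. This is needed when both entries of
the first row are units and right multiplication by `w` exchanges them. -/
lemma x_mul_w (t : Rˣ) :
    x t * w = y ((t⁻¹ : Rˣ) : R) * h (-t) * x (-((t⁻¹ : Rˣ) : R)) := by
  have h1 : x t = h t * w * x (-t) * y ((t⁻¹ : Rˣ) : R) := by
    rw [← P.w_unit, P.x_neg, P.y_neg]; group
  have h2 : y ((t⁻¹ : Rˣ) : R) * w = w * x (-((t⁻¹ : Rˣ) : R)) := by rw [P.w_x, neg_neg]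
  have h3 : x (-t) * w = w * y t := by rw [P.w_y]
  calc x t * w = h t * w * (x (-t) * (y ((t⁻¹ : Rˣ) : R) * w)) := by
        conv_lhs => rw [h1]
        group
    _ = h t * (w * w) * y t * x (-((t⁻¹ : Rˣ) : R)) := by
        rw [h2, ← mul_assoc (x (-t)), h3]; group
    _ = _ := by
        rw [← P.h_neg, P.h_y]
        congr 3
        simp [pow_two, mul_assoc]

lemma x_mul_y_neg_one (s : R) (t : Rˣ) (ht : s = 1 + (t : R)) :
    x s * y (-1) = y ((t⁻¹ : Rˣ) : R) * h (-t) * x (-((t⁻¹ : Rˣ) : R) - 1) := by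
  have h1 := P.w_unit 1
  simp only [P.h_one, Units.val_one, inv_one, one_mul] at h1
  have h2 : y (-1) = x (-1) * w * x (-1) := by rw [← h1, P.x_neg]; group
  rw [h2, sub_eq_add_neg (-_), P.x_add, ← mul_assoc, ← mul_assoc, ← mul_assoc, ← P.x_mul_w,
    ← P.x_add, ht]
  congr 3
  ring

open Classical in
/-- The Bruhat normal form of a matrix, evaluated in `Γ`. -/
noncomputable def normalForm (_ : SteinbergPair x y h w) (A : SpecialLinearGroup (Fin 2) R) : Γ :=
  if ha : IsUnit (A 0 0) then
    y (A 1 0 * ((ha.unit⁻¹ : Rˣ) : R)) * h ha.unit * x (((ha.unit⁻¹ : Rˣ) : R) * A 0 1)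
  else if hb : IsUnit (A 0 1) then
    y (A 1 1 * ((hb.unit⁻¹ : Rˣ) : R)) * h hb.unit *
      x (-(((hb.unit⁻¹ : Rˣ) : R) * A 0 0)) * w
  -- Never reached over a local ring: the first row of a matrix of determinant one contains a unit
  -- (`isUnit_zero_one`).
  else 1

lemma normalForm_of_unit {A : SpecialLinearGroup (Fin 2) R} (u : Rˣ) (hu : A 0 0 = u) :
    P.normalForm A = y (A 1 0 * ((u⁻¹ : Rˣ) : R)) * h u * x (((u⁻¹ : Rˣ) : R) * A 0 1) := by
  have ha : IsUnit (A 0 0) := hu ▸ u.isUnit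
  have : ha.unit = u := Units.ext hu
  rw [normalForm, dif_pos ha, this]

lemma normalForm_of_not_isUnit {A : SpecialLinearGroup (Fin 2) R} (ha : ¬ IsUnit (A 0 0))
    (u : Rˣ) (hu : A 0 1 = u) :
    P.normalForm A = y (A 1 1 * ((u⁻¹ : Rˣ) : R)) * h u *
      x (-(((u⁻¹ : Rˣ) : R) * A 0 0)) * w := by
  have hb : IsUnit (A 0 1) := hu ▸ u.isUnit
  have : hb.unit = u := Units.ext hu
  rw [normalForm, dif_neg ha, dif_pos hb, this]

lemma normalForm_diagE (u : Rˣ) : P.normalForm (diagE u) = h u := by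
  rw [P.normalForm_of_unit u (by simp [diagE])]
  simp [diagE, P.x_zero, P.y_zero]

lemma normalForm_one : P.normalForm 1 = 1 := by
  rw [P.normalForm_of_unit 1 (by simp)]
  simp [P.x_zero, P.y_zero, P.h_one]

variable [IsLocalRing R]

omit [Group Γ] P in
lemma isUnit_zero_one {A : SpecialLinearGroup (Fin 2) R} (ha : ¬ IsUnit (A 0 0)) :
    IsUnit (A 0 1) := by
  by_contra hb
  have hd := A.det_coe
  rw [det_fin_two] at hd
  have h1 : A 0 0 * A 1 1 ∈ nonunits R := mul_mem_nonunits_left ha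
  have h2 : -(A 0 1 * A 1 0) ∈ nonunits R := by
    intro h
    exact mul_mem_nonunits_left (b := A 1 0) hb (by simpa using h)
  exact IsLocalRing.nonunits_add h1 h2 (by rw [← sub_eq_add_neg, hd]; exact isUnit_one)

lemma normalForm_mul_weylE (A : SpecialLinearGroup (Fin 2) R) :
    P.normalForm (A * weylE) = P.normalForm A * w := by
  have hd := A.det_coe
  rw [det_fin_two] at hd
  have e00 : (A * weylE).1 0 0 = - A 0 1 := by
    rw [Matrix.SpecialLinearGroup.coe_mul]; simp [weylE, Matrix.mul_apply, Fin.sum_univ_two]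
  have e01 : (A * weylE).1 0 1 = A 0 0 := by
    rw [Matrix.SpecialLinearGroup.coe_mul]; simp [weylE, Matrix.mul_apply, Fin.sum_univ_two]
  have e10 : (A * weylE).1 1 0 = - A 1 1 := by
    rw [Matrix.SpecialLinearGroup.coe_mul]; simp [weylE, Matrix.mul_apply, Fin.sum_univ_two]
  have e11 : (A * weylE).1 1 1 = A 1 0 := by
    rw [Matrix.SpecialLinearGroup.coe_mul]; simp [weylE, Matrix.mul_apply, Fin.sum_univ_two]
  by_cases ha : IsUnit (A 0 0)
  · obtain ⟨a, ha'⟩ := ha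
    rw [P.normalForm_of_unit a ha'.symm]
    by_cases hb : IsUnit (A 0 1)
    · obtain ⟨b, hb'⟩ := hb
      rw [P.normalForm_of_unit (-b) (by rw [e00, ← hb']; simp), e10, e01, ← ha', ← hb']
      have h1 := P.x_mul_w (a⁻¹ * b)
      rw [Units.val_mul] at h1
      rw [mul_assoc (y _ * h a), h1, ← mul_assoc, ← mul_assoc, mul_assoc (y _) (h a), P.h_y,
        ← mul_assoc, ← P.y_add, mul_assoc (y _) (h a), ← P.h_mul]
      rw [← ha', ← hb'] at hd
      congr 1
      · congr 1
        · congr 1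
          simp only [inv_neg, Units.val_neg, _root_.mul_inv_rev, inv_inv, Units.val_mul]
          have ha1 : (a : R) * ((a⁻¹ : Rˣ) : R) = 1 := a.mul_inv
          have hb1 : (b : R) * ((b⁻¹ : Rˣ) : R) = 1 := b.mul_inv
          generalize ((a⁻¹ : Rˣ) : R) = a' at *
          generalize ((b⁻¹ : Rˣ) : R) = b' at *
          linear_combination (a' * b') * hd - (A 1 1 * b') * ha1 + (A 1 0 * a') * hb1
            - (a' * b') * ha1
        · congr 1; simp
      · congr 1; simp [mul_comm]
    · rw [P.normalForm_of_not_isUnit (by rw [e00]; simpa using hb) a (by rw [e01, ha']), e11, e00]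
      simp
  · obtain ⟨b, hb'⟩ := isUnit_zero_one ha
    rw [P.normalForm_of_not_isUnit ha b hb'.symm,
      P.normalForm_of_unit (-b) (by rw [e00, ← hb']; simp), e10, e01, P.h_neg, P.w_sq,
      mul_assoc _ w w, P.w_sq]
    have hc : h (-1) * x (-(((b⁻¹ : Rˣ) : R) * A 0 0)) = x (-(((b⁻¹ : Rˣ) : R) * A 0 0)) * h (-1) := by
      rw [P.h_x]; simp
    rw [mul_assoc _ (x _) (h (-1)), ← hc]
    simp [mul_assoc]

/-- Parameter `1` suffices, because the rings of interest are additively generated by `1`. In the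
cell ending in `w`, moving `x 1` past `w` produces `y (-1)`, which `x_mul_y_neg_one` absorbs since
`-1` is a unit. -/
lemma normalForm_mul_upperE_one (A : SpecialLinearGroup (Fin 2) R) :
    P.normalForm (A * upperE 1) = P.normalForm A * x 1 := by
  have e00 : (A * upperE 1).1 0 0 = A 0 0 := by
    rw [Matrix.SpecialLinearGroup.coe_mul]; simp [upperE, Matrix.mul_apply, Fin.sum_univ_two]
  have e01 : (A * upperE 1).1 0 1 = A 0 0 + A 0 1 := by
    rw [Matrix.SpecialLinearGroup.coe_mul]; simp [upperE, Matrix.mul_apply, Fin.sum_univ_two]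
  have e10 : (A * upperE 1).1 1 0 = A 1 0 := by
    rw [Matrix.SpecialLinearGroup.coe_mul]; simp [upperE, Matrix.mul_apply, Fin.sum_univ_two]
  have e11 : (A * upperE 1).1 1 1 = A 1 0 + A 1 1 := by
    rw [Matrix.SpecialLinearGroup.coe_mul]; simp [upperE, Matrix.mul_apply, Fin.sum_univ_two]
  have hd := A.det_coe
  rw [det_fin_two] at hd
  by_cases ha : IsUnit (A 0 0)
  · obtain ⟨a, ha'⟩ := ha
    rw [P.normalForm_of_unit a ha'.symm, P.normalForm_of_unit a (by rw [e00, ha']), e10, e01,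
      mul_assoc _ (x _) (x 1), ← P.x_add]
    congr 2
    rw [← ha']
    simp [mul_add, add_comm]
  · obtain ⟨b, hb'⟩ := isUnit_zero_one ha
    have hab : IsUnit (A 0 0 + A 0 1) := by
      by_contra hn
      have : A 0 1 ∈ nonunits R := by
        have := IsLocalRing.nonunits_add hn (b := -A 0 0) (by simpa using ha)
        simpa using this
      exact this ⟨b, hb'⟩
    obtain ⟨v, hv⟩ := hab
    rw [P.normalForm_of_not_isUnit ha b hb'.symm,
      P.normalForm_of_not_isUnit (by rwa [e00]) v (by rw [e01, hv]), e11, e00,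
      mul_assoc _ w (x 1), P.w_x, ← mul_assoc, mul_assoc _ (x _) (y (-1)),
      P.x_mul_y_neg_one _ (-(b⁻¹ * v)) (by
        rw [Units.val_neg, Units.val_mul, hv, ← hb', mul_add]
        simp)]
    rw [← mul_assoc, ← mul_assoc, mul_assoc (y _) (h b), P.h_y, ← mul_assoc, ← P.y_add,
      mul_assoc (y _) (h b), ← P.h_mul]
    have hb1 : (b : R) * ((b⁻¹ : Rˣ) : R) = 1 := b.mul_inv
    have hv1 : (v : R) * ((v⁻¹ : Rˣ) : R) = 1 := v.mul_inv
    rw [← hb'] at hd hv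
    congr 2
    · congr 1
      · congr 1
        simp only [inv_neg, Units.val_neg, _root_.mul_inv_rev, inv_inv, Units.val_mul]
        generalize ((v⁻¹ : Rˣ) : R) = v' at *
        generalize ((b⁻¹ : Rˣ) : R) = b' at *
        generalize (v : R) = v at *
        generalize (b : R) = b at *
        subst hv
        linear_combination (-v' * b') * hd + (b' * v' - A 1 0 * v' - A 1 1 * v') * hb1 +
          A 1 1 * b' * hv1
      · congr 1; simp
    · congr 1
      simp only [inv_neg, Units.val_neg, _root_.mul_inv_rev, inv_inv, Units.val_mul]
      generalize ((v⁻¹ : Rˣ) : R) = v' at *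
      generalize ((b⁻¹ : Rˣ) : R) = b' at *
      generalize (v : R) = v at *
      subst hv
      linear_combination -hv1

end SteinbergPair

end NormalForm

/-! ### Generation of the symplectic group over a local ring by transvections -/

namespace Sp

variable {g : ℕ} {R : Type} [CommRing R]

/-- The vector `v` has no component in the planes `⟨e_i, f_i⟩` with `i ∈ F`. -/
def Off (F : Finset (Fin g)) (v : Fin g ⊕ Fin g → R) : Prop :=
  ∀ i ∈ F, v (.inl i) = 0 ∧ v (.inr i) = 0

/-- The matrix `A` fixes `e_i` and `f_i` for `i ∈ F`. -/
def Fixes (F : Finset (Fin g)) (A : Sp g R) : Prop :=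
  ∀ i ∈ F, A • ev R i = ev R i ∧ A • fv R i = fv R i

lemma Off.add {F : Finset (Fin g)} {u v : Fin g ⊕ Fin g → R} (hu : Off F u) (hv : Off F v) :
    Off F (u + v) := fun i hi => by simp [hu i hi, hv i hi]

lemma Off.sub {F : Finset (Fin g)} {u v : Fin g ⊕ Fin g → R} (hu : Off F u) (hv : Off F v) :
    Off F (u - v) := fun i hi => by simp [hu i hi, hv i hi]

lemma Off.smul {F : Finset (Fin g)} {v : Fin g ⊕ Fin g → R} (c : R) (hv : Off F v) :
    Off F (c • v) := fun i hi => by simp [hv i hi]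

lemma off_ev {F : Finset (Fin g)} {j : Fin g} (h : j ∉ F) : Off F (ev R j) := fun i hi => by
  simp [ev, show i ≠ j from fun e => h (e ▸ hi)]

lemma off_fv {F : Finset (Fin g)} {j : Fin g} (h : j ∉ F) : Off F (fv R j) := fun i hi => by
  simp [fv, show i ≠ j from fun e => h (e ▸ hi)]

lemma Fixes.mul {F : Finset (Fin g)} {A B : Sp g R} (hA : Fixes F A) (hB : Fixes F B) :
    Fixes F (A * B) := fun i hi => by
  simp [mul_smul, hB i hi, hA i hi]

lemma Fixes.inv {F : Finset (Fin g)} {A : Sp g R} (hA : Fixes F A) : Fixes F A⁻¹ :=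
  fun i hi => ⟨inv_smul_eq_iff.2 (hA i hi).1.symm, inv_smul_eq_iff.2 (hA i hi).2.symm⟩

lemma Fixes.off_smul {F : Finset (Fin g)} {A : Sp g R} (hA : Fixes F A)
    {v : Fin g ⊕ Fin g → R} (hv : Off F v) : Off F (A • v) := fun i hi => by
  have h1 := sform_smul_smul A (ev R i) v
  have h2 := sform_smul_smul A (fv R i) v
  rw [(hA i hi).1, sform_ev_left, sform_ev_left, (hv i hi).2] at h1
  rw [(hA i hi).2, sform_fv_left, sform_fv_left, (hv i hi).1, neg_inj] at h2
  exact ⟨h2, h1⟩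

lemma fixes_T {F : Finset (Fin g)} {v : Fin g ⊕ Fin g → R} (hv : Off F v) (k : R) :
    Fixes F (T v k) := fun i hi =>
  ⟨T_smul_of_sform_eq_zero (by simp [sform_ev_right, hv i hi]) k,
    T_smul_of_sform_eq_zero (by simp [sform_fv_right, hv i hi]) k⟩

lemma fixes_S {F : Finset (Fin g)} {u v : Fin g ⊕ Fin g → R} (hu : Off F u) (hv : Off F v)
    (k : R) : Fixes F (S u v k) :=
  ((fixes_T (hu.add hv) _).mul (fixes_T hu _)).mul (fixes_T hv _)

/-- Two vectors that pair to a unit are exchanged by a single transvection along their difference.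
-/
lemma T_sub_smul {v v' : Fin g ⊕ Fin g → R} (k : R) (hk : k * sform v' v = 1) :
    T (v' - v) k • v = v' := by
  rw [T_smul]; simp [hk]

/-- A subgroup of `Sp` over a local ring that contains all transvections is everything. -/
theorem eq_top_of_transvections_mem [IsLocalRing R] (H : Subgroup (Sp g R))
    (hH : ∀ v k, T v k ∈ H) : H = ⊤ := by
  have key : ∀ F : Finset (Fin g), ∀ A : Sp g R, ∃ h ∈ H, Fixes F (h * A) := by
    intro F A
    induction F using Finset.induction_on with
    | empty => exact ⟨1, H.one_mem, fun i hi => by simp at hi⟩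
    | insert j F hj ih =>
      obtain ⟨h₀, hh₀, hA⟩ := ih
      have step : ∀ {B C : Sp g R}, B ∈ H → Fixes F B → (∃ h ∈ H, Fixes F (h * (B * C)) ∧
          Fixes {j} (h * (B * C))) → ∃ h ∈ H, Fixes F (h * C) ∧ Fixes {j} (h * C) := by
        rintro B C hB _ ⟨h, hh, h1, h2⟩
        exact ⟨h * B, H.mul_mem hh hB, by rwa [mul_assoc], by rwa [mul_assoc]⟩
      suffices h : ∀ C : Sp g R, Fixes F C → ∃ h ∈ H, Fixes F (h * C) ∧ Fixes {j} (h * C) by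
        obtain ⟨h, hh, h1, h2⟩ := h _ hA
        refine ⟨h * h₀, H.mul_mem hh hh₀, fun i hi => ?_⟩
        rw [mul_assoc]
        rcases Finset.mem_insert.1 hi with rfl | hi
        · exact h2 i (by simp)
        · exact h1 i hi
      have offe : Off F (ev R j) := off_ev hj
      have offf : Off F (fv R j) := off_fv hj
      have case3 : ∀ C : Sp g R, Fixes F C → C • ev R j = ev R j →
          ∃ h ∈ H, Fixes F (h * C) ∧ Fixes {j} (h * C) := by
        intro C hC he
        have hef : sform (ev R j) (C • fv R j) = 1 := by
          conv_lhs => rw [← he]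
          simp
        -- Chosen so that after a transvection along `e_j` the image of `f_j` pairs to `1` with
        -- `f_j`; then `T_sub_smul` applies. The difference is orthogonal to `e_j`, which therefore
        -- stays fixed.
        set c := 1 - sform (fv R j) (C • fv R j) with hc
        have hv : T (ev R j) (-c) • C • fv R j = C • fv R j - c • ev R j := by
          rw [T_smul, hef, mul_one, neg_smul, sub_eq_add_neg]
        set f' := T (ev R j) (-c) • C • fv R j with hf'
        have h1 : (1 : R) * sform (fv R j) f' = 1 := by rw [hv]; simp [hc]
        have hoff : Off F (fv R j - f') :=
          offf.sub ((fixes_T offe _).off_smul (hC.off_smul offf))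
        refine ⟨T (fv R j - f') 1 * T (ev R j) (-c), H.mul_mem (hH _ _) (hH _ _),
          ((fixes_T hoff _).mul (fixes_T offe _)).mul hC, fun i hi => ?_⟩
        rw [Finset.mem_singleton] at hi
        subst hi
        constructor
        · rw [mul_smul, mul_smul, he, T_smul_of_sform_eq_zero (sform_self _),
            T_smul_of_sform_eq_zero]
          rw [sform_sub_left, hv, sform_sub_left, sform_swap (C • _), hef]
          simp
        · rw [mul_smul, mul_smul, ← hf', T_sub_smul _ h1]
      have case2 : ∀ C : Sp g R, Fixes F C → IsUnit (sform (ev R j) (C • ev R j)) →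
          ∃ h ∈ H, Fixes F (h * C) ∧ Fixes {j} (h * C) := by
        rintro C hC ⟨u, hu⟩
        have hf := fixes_T (F := F) (offe.sub (hC.off_smul offe)) (u⁻¹ : Rˣ)
        refine step (hH _ _) hf (case3 _ (hf.mul hC) ?_)
        rw [mul_smul, T_sub_smul]
        rw [← hu]; simp
      intro C hC
      by_cases h0 : IsUnit (sform (ev R j) (C • ev R j))
      · exact case2 C hC h0
      -- When `e_j` and its image do not pair to a unit, pass through an intermediate `z` that pairs
      -- to a unit with both. One of `C • f_j`, `f_j` and their sum always serves.
      have case1 : ∀ z, Off F z → IsUnit (sform (C • ev R j) z) → IsUnit (sform (ev R j) z) →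
          ∃ h ∈ H, Fixes F (h * C) ∧ Fixes {j} (h * C) := by
        rintro z hz h1 h2
        rw [sform_swap, IsUnit.neg_iff] at h1
        obtain ⟨u, hu⟩ := h1
        have hf := fixes_T (F := F) (hz.sub (hC.off_smul offe)) (u⁻¹ : Rˣ)
        refine step (hH _ _) hf (case2 _ (hf.mul hC) ?_)
        rwa [mul_smul, T_sub_smul]
        rw [← hu]; simp
      by_cases h1 : IsUnit (sform (ev R j) (C • fv R j))
      · exact case1 _ (hC.off_smul offf) (by simp) h1
      by_cases h2 : IsUnit (sform (C • ev R j) (fv R j))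
      · exact case1 _ offf h2 (by simp)
      have aux : ∀ {a b : R}, ¬ IsUnit a → b = 1 → IsUnit (a + b) := by
        rintro a b ha rfl
        by_contra hn
        have := IsLocalRing.nonunits_add hn (b := -a) (by simpa using ha)
        simp at this
      refine case1 (C • fv R j + fv R j) ((hC.off_smul offf).add offf) ?_ ?_
      · rw [sform_add_right, add_comm]
        exact aux h2 (by simp)
      · rw [sform_add_right]
        exact aux h1 (by simp)
  rw [eq_top_iff]
  intro A _
  obtain ⟨h, hh, hA⟩ := key Finset.univ A
  have : h * A = 1 := ext_basis (fun i => by simp [(hA i (Finset.mem_univ i)).1])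
    (fun i => by simp [(hA i (Finset.mem_univ i)).2])
  rw [eq_inv_of_mul_eq_one_right this]
  exact H.inv_mem hh

end Sp

/-! ### The special linear group of a hyperbolic plane -/

section Plane

variable {g : ℕ} {R : Type} [CommRing R]

lemma sform_sum_right {ι : Type} (F : Finset ι) (u : Fin g ⊕ Fin g → R)
    (v : ι → Fin g ⊕ Fin g → R) : sform u (∑ i ∈ F, v i) = ∑ i ∈ F, sform u (v i) := by
  classical
  induction F using Finset.induction_on with
  | empty => simp
  | insert i F hi ih => rw [Finset.sum_insert hi, Finset.sum_insert hi, sform_add_right, ih]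

namespace Sp

/-- The matrix in `SL₂` acting on the plane `⟨e_i, f_i⟩`. -/
def plane (i : Fin g) (A : SpecialLinearGroup (Fin 2) R) : Sp g R :=
  ofLinear
    { toFun := fun x => x +
        (((A.1 0 0 - 1) * x (.inl i) + A.1 0 1 * x (.inr i)) • ev R i +
          (A.1 1 0 * x (.inl i) + (A.1 1 1 - 1) * x (.inr i)) • fv R i)
      map_add' := fun x y => by simp only [Pi.add_apply]; module
      map_smul' := fun c x => by simp only [Pi.smul_apply, smul_eq_mul, RingHom.id_apply]; module }
    (fun x y => by
      have hd := A.det_coe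
      rw [det_fin_two] at hd
      simp [sform_ev_left, sform_fv_left, sform_ev_right, sform_fv_right]
      simp [ev, fv]
      linear_combination (x (.inl i) * y (.inr i) - x (.inr i) * y (.inl i)) * hd)

lemma plane_smul (i : Fin g) (A : SpecialLinearGroup (Fin 2) R) (x : Fin g ⊕ Fin g → R) :
    plane i A • x = x +
        (((A.1 0 0 - 1) * x (.inl i) + A.1 0 1 * x (.inr i)) • ev R i +
          (A.1 1 0 * x (.inl i) + (A.1 1 1 - 1) * x (.inr i)) • fv R i) :=
  ofLinear_smul _ _ _

lemma plane_smul_ev (i : Fin g) (A : SpecialLinearGroup (Fin 2) R) :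
    plane i A • ev R i = A.1 0 0 • ev R i + A.1 1 0 • fv R i := by
  rw [plane_smul]
  simp only [show ev R i (.inl i) = 1 by simp [ev], show ev R i (.inr i) = 0 by simp [ev]]
  module

lemma plane_smul_fv (i : Fin g) (A : SpecialLinearGroup (Fin 2) R) :
    plane i A • fv R i = A.1 0 1 • ev R i + A.1 1 1 • fv R i := by
  rw [plane_smul]
  simp only [show fv R i (.inl i) = 0 by simp [fv], show fv R i (.inr i) = 1 by simp [fv]]
  module

lemma plane_smul_of_off {i : Fin g} (A : SpecialLinearGroup (Fin 2) R)
    {x : Fin g ⊕ Fin g → R} (h1 : x (.inl i) = 0) (h2 : x (.inr i) = 0) :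
    plane i A • x = x := by
  rw [plane_smul, h1, h2]; module

lemma plane_smul_ev_ne {i j : Fin g} (h : i ≠ j) (A : SpecialLinearGroup (Fin 2) R) :
    plane i A • ev R j = ev R j :=
  plane_smul_of_off A (by simp [ev, h]) (by simp [ev])

lemma plane_smul_fv_ne {i j : Fin g} (h : i ≠ j) (A : SpecialLinearGroup (Fin 2) R) :
    plane i A • fv R j = fv R j :=
  plane_smul_of_off A (by simp [fv]) (by simp [fv, h])

lemma plane_mul (i : Fin g) (A B : SpecialLinearGroup (Fin 2) R) :
    plane i (A * B) = plane i A * plane i B := by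
  have hc (C : Sp g R) (k : R) (y : Fin g ⊕ Fin g → R) : C • k • y = k • C • y := smul_comm C k y
  refine ext_basis (fun j => ?_) (fun j => ?_) <;> rw [mul_smul] <;> by_cases h : i = j
  · subst h
    simp only [plane_smul_ev, plane_smul_fv, smul_add, hc, Matrix.SpecialLinearGroup.coe_mul,
      Matrix.mul_apply, Fin.sum_univ_two]
    module
  · simp only [plane_smul_ev_ne h]
  · subst h
    simp only [plane_smul_ev, plane_smul_fv, smul_add, hc, Matrix.SpecialLinearGroup.coe_mul,
      Matrix.mul_apply, Fin.sum_univ_two]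
    module
  · simp only [plane_smul_fv_ne h]

lemma plane_one (i : Fin g) : plane i (1 : SpecialLinearGroup (Fin 2) R) = 1 :=
  ext_smul fun x => by rw [plane_smul]; simp

lemma plane_upperE (i : Fin g) (t : R) : plane i (upperE t) = T (ev R i) t :=
  ext_smul fun x => by
    rw [plane_smul, T_smul, sform_ev_left]
    simp [upperE]

lemma plane_lowerE (i : Fin g) (t : R) : plane i (lowerE t) = T (fv R i) (-t) :=
  ext_smul fun x => by
    rw [plane_smul, T_smul, sform_fv_left]
    simp [lowerE]

/-- A nonzero integral vector in the plane is its gcd times a primitive vector, which is the first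
column of a matrix in `SL₂(ℤ)`. This reduces statements about vectors in planes to multiples of
`e_i`. -/
lemma exists_plane_smul (i : Fin g) (a b : ℤ) :
    ∃ (A : SpecialLinearGroup (Fin 2) ℤ) (d : ℤ),
      a • ev ℤ i + b • fv ℤ i = plane i A • d • ev ℤ i := by
  have hc (C : Sp g ℤ) (k : ℤ) (y : Fin g ⊕ Fin g → ℤ) : C • k • y = k • C • y := smul_comm C k y
  by_cases h : Int.gcd a b = 0
  · obtain ⟨rfl, rfl⟩ := Int.gcd_eq_zero_iff.1 h
    exact ⟨1, 0, by simp⟩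
  · obtain ⟨a', b', hab, ha, hb⟩ := Int.exists_gcd_one (Nat.pos_of_ne_zero h)
    obtain ⟨A, h1, h2⟩ := (Int.isCoprime_iff_gcd_eq_one.2 hab).exists_SL2_col 0
    refine ⟨A, Int.gcd a b, ?_⟩
    rw [hc, plane_smul_ev, h1, h2, smul_add, smul_smul, smul_smul, mul_comm _ a', mul_comm _ b',
      ← ha, ← hb]

end Sp

end Plane

/-! ### Powers of transvections in a central quotient -/

namespace Sp

variable {g m : ℕ} {Γ : Type} [Group Γ]

/-- The images under `q` of the matrices congruent to `1` modulo `m` are central. -/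
def CentralMod (m : ℕ) (q : Sp g ℤ →* Γ) : Prop :=
  ∀ A, reduce g m A = 1 → ∀ B, Commute (q A) (q B)

lemma CentralMod.conj {q : Sp g ℤ →* Γ} (hq : CentralMod m q) {A : Sp g ℤ}
    (hA : reduce g m A = 1) (B : Sp g ℤ) : q (B * A * B⁻¹) = q A := by
  rw [map_mul, map_mul, map_inv, ← (hq A hA B).eq, mul_inv_cancel_right]

lemma reduce_T (v : Fin g ⊕ Fin g → ℤ) (k : ℤ) :
    reduce g m (T v k) = T (fun i => (v i : ZMod m)) (k : ZMod m) := map_T _ _ _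

lemma reduce_T_mul (v : Fin g ⊕ Fin g → ℤ) (k : ℤ) : reduce g m (T v (m * k)) = 1 := by
  rw [reduce_T]; simp

lemma reduce_T_self (v : Fin g ⊕ Fin g → ℤ) : reduce g m (T v m) = 1 := by
  simpa using reduce_T_mul v 1

lemma reduce_S_mul (u v : Fin g ⊕ Fin g → ℤ) (k : ℤ) : reduce g m (S u v (m * k)) = 1 := by
  simp only [S, map_mul, ← mul_neg, reduce_T_mul, one_mul]

lemma S_zpow {R : Type} [CommRing R] {u v : Fin g ⊕ Fin g → R} (h : sform u v = 0) (k : R)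
    (n : ℤ) : S u v k ^ n = S u v (n * k) := by
  induction n with
  | zero => simp [S_zero]
  | succ n ih => rw [_root_.zpow_add_one, ih, ← S_add h]; congr 1; push_cast; ring
  | pred n ih => rw [_root_.zpow_sub_one, ih, ← S_neg h, ← S_add h]; congr 1; push_cast; ring

section

variable {q : Sp g ℤ →* Γ} (hq : CentralMod m q) (hm : Even m)
include hq hm

/-- Let `a`, `b`, `c` be the images of the level `m` elements for `e_i`, `e_j` and the pair.
Conjugate transvections of level `m` have equal images, so expanding those along `e_i ± e_j` gives
`a = b = c` and `a ^ 2 = 1`. A further relation `a ^ m * c = 1` finishes, since `m` is even. -/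
lemma CentralMod.basis {i j : Fin g} (hij : i ≠ j) :
    q (T (ev ℤ i) m) = 1 ∧ q (S (ev ℤ i) (ev ℤ j) m) = 1 := by
  have hji := hij.symm
  have eji : sform (ev ℤ j) (fv ℤ i) = 0 := sform_ev_fv_ne hji
  have eij : sform (ev ℤ i) (fv ℤ j) = 0 := sform_ev_fv_ne hij
  have fji : sform (fv ℤ j) (ev ℤ i) = 0 := sform_fv_ev_ne hji
  have t1 : q (T (ev ℤ i + ev ℤ j) m) = q (T (ev ℤ i) m) := by
    rw [← hq.conj (reduce_T_self (ev ℤ i)) (S (ev ℤ j) (fv ℤ i) (-1)), conj_T, S_smul eji]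
    congr 2
    simp
  have t2 : q (T (ev ℤ i + -ev ℤ j) m) = q (T (ev ℤ i) m) := by
    rw [← hq.conj (reduce_T_self (ev ℤ i)) (S (ev ℤ j) (fv ℤ i) 1), conj_T, S_smul eji]
    congr 2
    simp
  have t3 : q (T (ev ℤ i + ev ℤ j) m) = q (T (ev ℤ j) m) := by
    rw [← hq.conj (reduce_T_self (ev ℤ j)) (S (ev ℤ i) (fv ℤ j) (-1)), conj_T, S_smul eij]
    congr 2
    simp [add_comm]
  rw [T_add_vec (sform_ev_ev i j), map_mul, map_mul] at t1 t3
  rw [T_add_vec (by simp), map_mul, map_mul, T_neg_vec, S_neg_right_vec (sform_ev_ev i j),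
    S_neg (sform_ev_ev i j), map_inv] at t2
  -- Here the conjugating matrix, rather than the transvection, has level `m`. Expanding the left
  -- side yields `T (e_i)` with parameter `m ^ 2` and the short root element with parameter `m`.
  have t4 : q (T (ev ℤ j + (m : ℤ) • ev ℤ i) 1) = q (T (ev ℤ j) 1) := by
    have hr : reduce g m (S (ev ℤ i) (fv ℤ j) (-m)) = 1 := by
      simpa using reduce_S_mul (m := m) (ev ℤ i) (fv ℤ j) (-1)
    have := conj_T (S (ev ℤ i) (fv ℤ j) (-m)) (ev ℤ j) 1
    rw [S_smul eij] at this
    simp only [sform_ev_ev, sform_fv_ev, mul_zero, mul_neg, mul_one, neg_neg, zero_smul,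
      add_zero] at this
    rw [← this, map_mul, map_mul, map_inv, (hq _ hr _).eq, mul_inv_cancel_right]
  have t5 : q (T (ev ℤ i) m) ^ (m : ℤ) * q (S (ev ℤ i) (ev ℤ j) m) = 1 := by
    rw [T_add_vec (by rw [sform_smul_right, sform_ev_ev, mul_zero]), map_mul, map_mul, T_smul_vec,
      S_smul_right_vec (sform_ev_ev j i),
      mul_assoc, mul_eq_left] at t4
    rw [← map_zpow, T_zpow, ← S_comm _ _ (sform_ev_ev j i), ← t4]
    congr 3
    · push_cast; ring
    · ring
  generalize q (T (ev ℤ i) m) = a at *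
  generalize q (T (ev ℤ j) m) = b at *
  generalize q (S (ev ℤ i) (ev ℤ j) m) = c at *
  rw [mul_assoc, mul_eq_left] at t1 t2
  rw [mul_assoc, t1, mul_one] at t3
  have hb : b = c := mul_inv_eq_one.1 t2
  subst t3 hb
  have h2 : a ^ (m : ℤ) = 1 := by
    obtain ⟨k, hk⟩ := hm
    rw [hk, Nat.cast_add, _root_.zpow_add, ← (Commute.refl a).mul_zpow, t1, _root_.one_zpow]
  rw [h2, one_mul] at t5
  exact ⟨t5, t5⟩

lemma CentralMod.S_basis {i j : Fin g} (hij : i ≠ j) (c d : ℤ) :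
    q (S (c • ev ℤ i) (d • ev ℤ j) m) = 1 := by
  rw [S_smul_left_vec (by rw [sform_smul_right, sform_ev_ev, mul_zero]),
    S_smul_right_vec (sform_ev_ev i j), ← mul_assoc, ← Int.cast_id (n := d * c),
    ← S_zpow (sform_ev_ev i j), map_zpow, (hq.basis hm hij).2, _root_.one_zpow]

lemma CentralMod.T_basis (hg : 2 ≤ g) (i : Fin g) (c : ℤ) : q (T (c • ev ℤ i) m) = 1 := by
  have : Nontrivial (Fin g) := Fin.nontrivial_iff_two_le.2 hg
  obtain ⟨j, hj⟩ := exists_ne i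
  rw [T_smul_vec, ← Int.cast_id (n := c ^ 2), ← T_zpow, map_zpow, (hq.basis hm hj.symm).1, _root_.one_zpow]

/-- The component of a vector in the plane `⟨e_i, f_i⟩`. -/
abbrev planePart (v : Fin g ⊕ Fin g → ℤ) (i : Fin g) : Fin g ⊕ Fin g → ℤ :=
  v (.inl i) • ev ℤ i + v (.inr i) • fv ℤ i

omit hq hm in
lemma sform_planePart {i j : Fin g} (hij : i ≠ j) (u v : Fin g ⊕ Fin g → ℤ) :
    sform (planePart u i) (planePart v j) = 0 := by
  simp only [sform_add_left, sform_add_right, sform_smul_left, sform_smul_right, sform_ev_ev,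
    sform_fv_fv, sform_ev_fv_ne hij, sform_fv_ev_ne hij, mul_zero, add_zero]

omit hq hm in
lemma sform_planePart_sum {i : Fin g} {F : Finset (Fin g)} (hi : i ∉ F)
    (u v : Fin g ⊕ Fin g → ℤ) : sform (planePart u i) (∑ j ∈ F, planePart v j) = 0 := by
  rw [sform_sum_right]
  exact Finset.sum_eq_zero fun j hj =>
    sform_planePart (ne_of_mem_of_not_mem hj hi).symm u v

/-- The commuting groups `SL₂(ℤ)` of the two planes move both components simultaneously to multiples
of `e_i` and `e_j`. -/
lemma CentralMod.S_planePart {i j : Fin g} (hij : i ≠ j) (u v : Fin g ⊕ Fin g → ℤ) :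
    q (S (planePart u i) (planePart v j) m) = 1 := by
  obtain ⟨A, c, hA⟩ := exists_plane_smul i (u (.inl i)) (u (.inr i))
  obtain ⟨B, d, hB⟩ := exists_plane_smul j (v (.inl j)) (v (.inr j))
  have hc (C : Sp g ℤ) (k : ℤ) (y : Fin g ⊕ Fin g → ℤ) : C • k • y = k • C • y := smul_comm C k y
  have e1 : planePart u i = (plane i A * plane j B) • c • ev ℤ i := by
    rw [planePart, hA, mul_smul, hc (plane j B), plane_smul_ev_ne hij.symm]
  have e2 : planePart v j = (plane i A * plane j B) • d • ev ℤ j := by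
    rw [planePart, hB, mul_smul, hc (plane j B), plane_smul_ev, smul_add, smul_add, hc, hc, hc, hc,
      plane_smul_ev_ne hij, plane_smul_fv_ne hij]
  rw [e1, e2, ← conj_S, map_mul, map_mul, hq.S_basis hm hij, mul_one, ← map_mul, mul_inv_cancel,
    map_one]

lemma CentralMod.S_planePart_sum {i : Fin g} (u v : Fin g ⊕ Fin g → ℤ) (F : Finset (Fin g))
    (hi : i ∉ F) : q (S (planePart u i) (∑ j ∈ F, planePart v j) m) = 1 := by
  induction F using Finset.induction_on with
  | empty =>
    have : S (planePart u i) 0 (m : ℤ) = 1 := ext_smul fun x => by rw [S_smul] <;> simp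
    simp [this]
  | insert j F hj ih =>
    rw [Finset.mem_insert, not_or] at hi
    rw [Finset.sum_insert hj, S_add_right_vec (sform_planePart hi.1 u v)
      (sform_planePart_sum hi.2 u v) (sform_planePart_sum hj v v), map_mul,
      hq.S_planePart hm hi.1, ih hi.2, one_mul]

/-- Under a homomorphism that makes the level `m` matrices central, `m` even, all `m`-th powers of
transvections are trivial. -/
theorem CentralMod.T_eq_one (hg : 2 ≤ g) (v : Fin g ⊕ Fin g → ℤ) : q (T v m) = 1 := by
  rw [eq_sum_ev_fv v]
  generalize (Finset.univ : Finset (Fin g)) = F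
  induction F using Finset.induction_on with
  | empty =>
    have : T (0 : Fin g ⊕ Fin g → ℤ) (m : ℤ) = 1 := ext_smul fun x => by simp [T_smul]
    simp [this]
  | insert i F hi ih =>
    rw [Finset.sum_insert hi, T_add_vec (sform_planePart_sum hi v v), map_mul, map_mul, ih, mul_one,
      hq.S_planePart_sum hm v v F hi, mul_one]
    obtain ⟨A, c, hA⟩ := exists_plane_smul i (v (.inl i)) (v (.inr i))
    rw [planePart, hA, ← conj_T, map_mul, map_mul, hq.T_basis hm hg, mul_one, ← map_mul, mul_inv_cancel,
      map_one]

end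

end Sp

/-! ### Column reduction of matrices of level `m` -/

lemma Int.exists_isCoprime_add_mul {a b c : ℤ} (ha : a ≠ 0)
    (h : ∃ x y z : ℤ, x * a + y * b + z * c = 1) : ∃ k : ℤ, IsCoprime a (b + k * c) := by
  classical
  obtain ⟨x, y, z, h⟩ := h
  let s : Finset ℕ := a.natAbs.primeFactors.filter fun p : ℕ => ¬ (p : ℤ) ∣ b
  -- With `k` the product of the primes dividing `a` but not `b`, each prime divisor of `a` divides
  -- exactly one of `b` and `k * c`.
  refine ⟨∏ p ∈ s, (p : ℤ), ?_⟩
  rw [Int.isCoprime_iff_gcd_eq_one]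
  by_contra hg
  obtain ⟨p, hp, hpd⟩ := Nat.exists_prime_and_dvd hg
  have hpa : (p : ℤ) ∣ a := (Int.natCast_dvd_natCast.2 hpd).trans (Int.gcd_dvd_left _ _)
  have hpb : (p : ℤ) ∣ b + (∏ p ∈ s, (p : ℤ)) * c :=
    (Int.natCast_dvd_natCast.2 hpd).trans (Int.gcd_dvd_right _ _)
  have hp' : Prime (p : ℤ) := Nat.prime_iff_prime_int.1 hp
  have hps : p ∈ a.natAbs.primeFactors :=
    Nat.mem_primeFactors.2 ⟨hp, Int.natCast_dvd.1 hpa, Int.natAbs_ne_zero.2 ha⟩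
  by_cases hb : (p : ℤ) ∣ b
  · rcases hp'.dvd_or_dvd ((dvd_add_right hb).1 hpb) with hk | hc
    · obtain ⟨r, hr, hpr⟩ := (hp'.dvd_finsetProd_iff _).1 hk
      obtain ⟨hr1, hr2⟩ := Finset.mem_filter.1 hr
      have := (Nat.prime_dvd_prime_iff_eq hp (Nat.prime_of_mem_primeFactors hr1)).1
        (Int.natCast_dvd_natCast.1 hpr)
      exact hr2 (this ▸ hb)
    · exact hp'.not_dvd_one (h ▸ dvd_add (dvd_add (hpa.mul_left _) (hb.mul_left _)) (hc.mul_left _))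
  · have hk : (p : ℤ) ∣ ∏ p ∈ s, (p : ℤ) :=
      Finset.dvd_prod_of_mem (fun p : ℕ => (p : ℤ)) (Finset.mem_filter.2 ⟨hps, hb⟩)
    exact hb ((dvd_add_left (hk.mul_right c)).1 hpb)

namespace Sp

variable {g m : ℕ}

lemma exists_smul_eq_add {A : Sp g ℤ} (hA : reduce g m A = 1) (x : Fin g ⊕ Fin g → ℤ) :
    ∃ w : Fin g ⊕ Fin g → ℤ, A • x = x + (m : ℤ) • w := by
  have h := map_smul_comp (Int.castRingHom (ZMod m)) A x
  change reduce g m A • _ = _ at h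
  rw [hA, one_smul] at h
  have h1 : ∀ i, ∃ w : ℤ, (A • x) i = x i + m * w := by
    intro i
    have h2 := congrFun h i
    simp only [Function.comp_apply, eq_intCast] at h2
    obtain ⟨w, hw⟩ := (ZMod.intCast_eq_intCast_iff_dvd_sub _ _ _).1 h2
    exact ⟨w, by rw [← hw]; ring⟩
  choose w hw using h1
  exact ⟨w, funext hw⟩

lemma eq_add_off (j : Fin g) {R : Type} [CommRing R] (x : Fin g ⊕ Fin g → R) :
    ∃ r, x = x (.inl j) • ev R j + x (.inr j) • fv R j + r ∧ sform (ev R j) r = 0 ∧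
      sform (fv R j) r = 0 ∧ ∀ F, j ∉ F → Off F x → Off F r := by
  refine ⟨x - (x (.inl j) • ev R j + x (.inr j) • fv R j), by abel, ?_, ?_, fun F hj hx =>
    hx.sub (((off_ev hj).smul _).add ((off_fv hj).smul _))⟩
  · simp [sform_ev_left j x]
  · simp [sform_fv_left j x]

section

variable {N : Subgroup (Sp g ℤ)} (hT : ∀ v, T v (m : ℤ) ∈ N)
include hT

lemma T_mul_mem (v : Fin g ⊕ Fin g → ℤ) (k : ℤ) : T v (m * k) ∈ N := by
  rw [mul_comm, ← Int.cast_id (n := k), ← T_zpow]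
  exact N.zpow_mem (hT v) k

lemma S_mul_mem (u v : Fin g ⊕ Fin g → ℤ) (k : ℤ) : S u v (m * k) ∈ N := by
  rw [S, ← mul_neg]
  exact N.mul_mem (N.mul_mem (T_mul_mem hT _ _) (T_mul_mem hT _ _)) (T_mul_mem hT _ _)

variable {F : Finset (Fin g)} {j l : Fin g} (hj : j ∉ F)
include hj

lemma exists_isCoprime_column (hm : Even m) {A : Sp g ℤ} (hA : reduce g m A = 1)
    (hF : Fixes F A) : ∃ h ∈ N, Fixes F h ∧
      IsCoprime ((h • A • ev ℤ j) (.inl j)) ((h • A • ev ℤ j) (.inr j)) := by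
  obtain ⟨w, hw⟩ := exists_smul_eq_add hA (ev ℤ j)
  obtain ⟨r, hr, hre, hrf, hrF⟩ := eq_add_off j (A • fv ℤ j)
  have hrF := hrF F hj (hF.off_smul (off_fv hj))
  have h1 : sform (A • ev ℤ j) (A • fv ℤ j) = 1 := by simp
  have ha : (A • ev ℤ j) (.inl j) = 1 + m * w (.inl j) := by rw [hw]; simp [ev]
  set v := A • ev ℤ j with hv
  set a := v (.inl j)
  set b := v (.inr j)
  set p := (A • fv ℤ j) (.inl j)
  set s := (A • fv ℤ j) (.inr j)
  rw [hr, sform_add_right, sform_add_right, sform_smul_right, sform_smul_right, sform_ev_right,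
    sform_fv_right] at h1
  -- The diagonal entry is odd, because `m` is even.
  have ha0 : a ≠ 0 := by
    intro h
    obtain ⟨k, rfl⟩ := hm
    push_cast at ha
    rw [h] at ha
    have : (2 : ℤ) * (k * w (.inl j)) = -1 := by linear_combination -ha
    omega
  -- Level `m` operations add only multiples of `m * sform v r` to `b`. The triple is still
  -- unimodular: the pairing of the two columns gives `s * a - p * b + sform v r = 1`, and `a` is
  -- `1` modulo `m`.
  obtain ⟨k, hk⟩ := Int.exists_isCoprime_add_mul (a := a) (b := b) (c := m * sform v r) ha0
    ⟨s + sform v r, -p, -w (.inl j), by linear_combination h1 + (sform v r) * ha⟩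
  refine ⟨S (fv ℤ j) r (m * (-k)), S_mul_mem hT _ _ _, fixes_S (off_fv hj) hrF _, ?_⟩
  rw [S_smul hrf]
  convert hk using 1
  · rw [sform_ev_left] at hre
    rw [sform_fv_left] at hrf
    simp [fv, neg_eq_zero.1 hrf, a]
  · rw [sform_ev_left] at hre
    simp only [Pi.add_apply, Pi.smul_apply, hre, sform_swap r v, fv, Pi.single_eq_same, smul_eq_mul]
    ring

/-- A Bézout relation for the two entries in plane `j` gives a vector of that plane pairing to `-1`
with the column, so components in other planes can be altered by any multiple of `m`. The excess `m
* a'` on the diagonal is then moved to the spare plane `l` and cleared there. -/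
lemma exists_column_eq_of_isCoprime [N.Normal] (hl : l ∉ F) (hjl : j ≠ l) {A : Sp g ℤ}
    (hA : reduce g m A = 1) (hm : m ≠ 0) (hF : Fixes F A)
    (hc : IsCoprime ((A • ev ℤ j) (.inl j)) ((A • ev ℤ j) (.inr j))) :
    ∃ h ∈ N, Fixes F h ∧ h • A • ev ℤ j = ev ℤ j := by
  have hlj := hjl.symm
  obtain ⟨w, hw⟩ := exists_smul_eq_add hA (ev ℤ j)
  have hwF : Off F w := by
    have h1 : Off F ((m : ℤ) • w) := by
      have := (hF.off_smul (off_ev (R := ℤ) hj)).sub (off_ev hj)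
      rwa [hw, add_sub_cancel_left] at this
    intro i hi
    have := h1 i hi
    simpa [hm] using this
  obtain ⟨r, hr, hre, hrf, hrF⟩ := eq_add_off j w
  have hrF := hrF F hj hwF
  have hre' : sform r (ev ℤ j) = 0 := by rw [sform_swap, hre, neg_zero]
  have hrf' : sform r (fv ℤ j) = 0 := by rw [sform_swap, hrf, neg_zero]
  have ha : (A • ev ℤ j) (.inl j) = 1 + m * w (.inl j) := by rw [hw]; simp [ev]
  have hb : (A • ev ℤ j) (.inr j) = m * w (.inr j) := by rw [hw]; simp [ev]
  rw [ha, hb] at hc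
  set a' := w (.inl j)
  set b' := w (.inr j)
  obtain ⟨p, s, hps⟩ := hc
  rw [hw, hr]
  have hz : ∀ u : Fin g ⊕ Fin g → ℤ, sform (ev ℤ j) u = 0 → sform (fv ℤ j) u = 0 →
      sform (p • fv ℤ j - s • ev ℤ j) u = 0 := fun u h1 h2 => by simp [-zsmul_eq_mul, h1, h2]
  have hzF : Off F (p • fv ℤ j - s • ev ℤ j) := ((off_fv hj).smul p).sub ((off_ev hj).smul s)
  have hej : sform (ev ℤ j) (ev ℤ l) = 0 := sform_ev_ev _ _
  have hfj : sform (fv ℤ j) (ev ℤ l) = 0 := sform_fv_ev_ne hjl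
  have hel : sform (ev ℤ l) (fv ℤ j) = 0 := sform_ev_fv_ne hlj
  have hjf : sform (ev ℤ j) (fv ℤ l) = 0 := sform_ev_fv_ne hjl
  have hlf : sform (fv ℤ l) (ev ℤ j) = 0 := sform_fv_ev_ne hlj
  set r₂ := a' • ev ℤ l + b' • fv ℤ l with hr₂
  have hr₂F : Off F r₂ := ((off_ev hl).smul _).add ((off_fv hl).smul _)
  have hr₂e : sform (fv ℤ j) r₂ = 0 := by simp [-zsmul_eq_mul, hr₂, hfj]
  let h₁ := S (p • fv ℤ j - s • ev ℤ j) r (m * 1)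
  let h₂ := S (p • fv ℤ j - s • ev ℤ j) (ev ℤ l) (m * (-a'))
  -- This element does not have level `m`. It trades the coefficient of `e_l` for the excess in that
  -- of `e_j`; as it fixes `e_j`, it enters the final product only through a conjugate of `h₄ * h₃`,
  -- which normality keeps in `N`.
  let γ := S (ev ℤ j) (fv ℤ l) 1
  let h₃ := T (fv ℤ j) (m * b')
  let h₄ := S (fv ℤ j) r₂ (m * 1)
  have e₁ : h₁ • (ev ℤ j + (m : ℤ) • (a' • ev ℤ j + b' • fv ℤ j + r)) =
      ev ℤ j + (m : ℤ) • (a' • ev ℤ j + b' • fv ℤ j) := by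
    rw [S_smul (hz _ hre hrf)]
    simp only [sform_add_right, sform_smul_right, sform_sub_left, sform_smul_left,
      sform_ev_fv, sform_fv_ev, hre, hrf, hre', hrf', sform_self]
    linear_combination (exp := 1) (-(m : ℤ) * hps) • (r)
  have e₂ : h₂ • (ev ℤ j + (m : ℤ) • (a' • ev ℤ j + b' • fv ℤ j)) =
      ev ℤ j + (m : ℤ) • (a' • ev ℤ j + b' • fv ℤ j) + ((m : ℤ) * a') • ev ℤ l := by
    rw [S_smul (hz _ hej hfj)]
    simp only [sform_add_right, sform_smul_right, sform_sub_left, sform_smul_left, sform_ev_ev,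
      sform_fv_fv, sform_ev_fv, sform_fv_ev, hel]
    linear_combination (exp := 1) ((m : ℤ) * a' * hps) • (ev ℤ l)
  have e₃ : γ • (ev ℤ j + (m : ℤ) • (a' • ev ℤ j + b' • fv ℤ j) + ((m : ℤ) * a') • ev ℤ l) =
      ev ℤ j + ((m : ℤ) * b') • fv ℤ j + (m : ℤ) • r₂ := by
    rw [S_smul hjf]
    simp only [sform_add_right, sform_smul_right, sform_ev_ev,
      sform_fv_fv, sform_ev_fv, sform_fv_ev, hlf, hr₂]
    module
  have e₄ : h₃ • (ev ℤ j + ((m : ℤ) * b') • fv ℤ j + (m : ℤ) • r₂) = ev ℤ j + (m : ℤ) • r₂ := by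
    rw [T_smul]
    simp only [sform_add_right, sform_smul_right, sform_fv_fv, sform_fv_ev, hr₂e]
    module
  have e₅ : h₄ • (ev ℤ j + (m : ℤ) • r₂) = ev ℤ j := by
    have : sform r₂ (ev ℤ j) = 0 := by simp [-zsmul_eq_mul, hr₂, hlf]
    rw [S_smul hr₂e]
    simp only [sform_add_right, sform_smul_right, sform_fv_ev, hr₂e, sform_self, this]
    module
  have e₆ : γ⁻¹ • ev ℤ j = ev ℤ j := by
    rw [inv_smul_eq_iff, S_smul hjf]
    simp [hlf]
  have hγ : Fixes F γ := fixes_S (off_ev hj) (off_fv hl) _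
  refine ⟨γ⁻¹ * (h₄ * h₃) * γ * (h₂ * h₁), ?_, ?_, ?_⟩
  · refine N.mul_mem ?_ (N.mul_mem (S_mul_mem hT _ _ _) (S_mul_mem hT _ _ _))
    simpa using (inferInstance : N.Normal).conj_mem _
      (N.mul_mem (S_mul_mem hT _ _ _) (T_mul_mem hT _ _)) γ⁻¹
  · exact ((hγ.inv.mul ((fixes_S (off_fv hj) hr₂F _).mul (fixes_T (off_fv hj) _))).mul hγ).mul
      ((fixes_S hzF (off_ev hl) _).mul (fixes_S hzF hrF _))
  · rw [mul_smul, mul_smul, mul_smul, mul_smul, mul_smul, e₁, e₂, e₃, e₄, e₅, e₆]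

lemma exists_fixes_plane {A : Sp g ℤ} (hA : reduce g m A = 1) (hm : m ≠ 0) (hF : Fixes F A)
    (he : A • ev ℤ j = ev ℤ j) : ∃ h ∈ N, Fixes (insert j F) (h * A) := by
  obtain ⟨w, hw⟩ := exists_smul_eq_add hA (fv ℤ j)
  have hwF : Off F w := by
    have h1 : Off F ((m : ℤ) • w) := by
      have := (hF.off_smul (off_fv (R := ℤ) hj)).sub (off_fv hj)
      rwa [hw, add_sub_cancel_left] at this
    intro i hi
    have := h1 i hi
    simpa [hm] using this
  have hew : sform (ev ℤ j) w = 0 := by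
    have h1 := sform_smul_smul A (ev ℤ j) (fv ℤ j)
    rw [he, hw, sform_add_right, sform_smul_right, add_eq_left] at h1
    simpa [hm] using h1
  have hwe : sform w (ev ℤ j) = 0 := by rw [sform_swap, hew, neg_zero]
  -- A transvection along `e_j` replaces `w` by `w'` with `sform w' f_j = 1`; the transvection along
  -- `w'` with parameter `-m` then removes `m • w'`.
  set c := 1 - sform w (fv ℤ j) with hc
  set w' := w + c • ev ℤ j with hw'
  have hw'F : Off F w' := hwF.add ((off_ev hj).smul _)
  refine ⟨T w' (m * (-1)) * T (ev ℤ j) (m * c), N.mul_mem (T_mul_mem hT _ _) (T_mul_mem hT _ _),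
    fun i hi => ?_⟩
  rcases Finset.mem_insert.1 hi with rfl | hi
  · rw [mul_smul, mul_smul, mul_smul, mul_smul, he, hw, T_smul_of_sform_eq_zero (sform_self _),
      T_smul_of_sform_eq_zero (by simp [-zsmul_eq_mul, hw', hwe])]
    refine ⟨rfl, ?_⟩
    have e1 : T (ev ℤ i) (m * c) • (fv ℤ i + (m : ℤ) • w) = fv ℤ i + (m : ℤ) • w' := by
      rw [T_smul, sform_add_right, sform_smul_right, hew, sform_ev_fv, hw']; module
    have e2 : sform w' (fv ℤ i) = 1 := by simp [-zsmul_eq_mul, hw', hc]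
    rw [e1, T_smul, sform_add_right, sform_smul_right, sform_self, e2]; module
  · exact (((fixes_T hw'F _).mul (fixes_T (off_ev hj) _)).mul hF) i hi

end

/-- A normal subgroup of level `m` that contains the `m`-th powers of all transvections moves every
matrix of level `m` into the special linear group of a plane. -/
theorem exists_fixes_compl {N : Subgroup (Sp g ℤ)} [N.Normal] (hT : ∀ v, T v (m : ℤ) ∈ N)
    (hN : N ≤ (reduce g m).ker) (hm : Even m) (hm0 : m ≠ 0) {A : Sp g ℤ} (hA : reduce g m A = 1)
    (l : Fin g) (F : Finset (Fin g)) (hl : l ∉ F) : ∃ h ∈ N, Fixes F (h * A) := by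
  induction F using Finset.induction_on with
  | empty => exact ⟨1, N.one_mem, fun i hi => by simp at hi⟩
  | insert j F hj ih =>
    rw [Finset.mem_insert, not_or] at hl
    have hr : ∀ {h : Sp g ℤ} {B : Sp g ℤ}, h ∈ N → reduce g m B = 1 → reduce g m (h * B) = 1 := by
      intro h B hh hB
      rw [map_mul, hB, MonoidHom.mem_ker.1 (hN hh), one_mul]
    obtain ⟨h₀, hh₀, hF₀⟩ := ih hl.2
    have hA₀ := hr hh₀ hA
    obtain ⟨h₁, hh₁, hF₁, hc⟩ := exists_isCoprime_column hT hj hm hA₀ hF₀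
    rw [← mul_smul] at hc
    obtain ⟨h₂, hh₂, hF₂, he⟩ := exists_column_eq_of_isCoprime hT hj hl.2 (Ne.symm hl.1)
      (hr hh₁ hA₀) hm0 (hF₁.mul hF₀) hc
    rw [← mul_smul] at he
    obtain ⟨h₃, hh₃, hF₃⟩ := exists_fixes_plane hT hj (hr hh₂ (hr hh₁ hA₀)) hm0
      (hF₂.mul (hF₁.mul hF₀)) he
    refine ⟨h₃ * (h₂ * (h₁ * h₀)), N.mul_mem hh₃ (N.mul_mem hh₂ (N.mul_mem hh₁ hh₀)), ?_⟩
    simpa only [mul_assoc] using hF₃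

end Sp

/-! ### Root elements with parameters modulo `m` -/

open scoped commutatorElement

namespace Sp

variable {g m : ℕ} {Γ : Type} [Group Γ]

/-- The homomorphism `q` makes the level `m` matrices central and kills the `m`-th powers of
transvections. -/
structure KillsLevel (m : ℕ) (q : Sp g ℤ →* Γ) : Prop where
  central : CentralMod m q
  T_eq_one : ∀ v, q (T v m) = 1

/-- The image of a transvection, with a parameter modulo `m`. -/
def tv (q : Sp g ℤ →* Γ) (v : Fin g ⊕ Fin g → ℤ) (t : ZMod m) : Γ := q (T v (t.cast : ℤ))

/-- The image of a short root element, with a parameter modulo `m`. -/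
def sv (q : Sp g ℤ →* Γ) (u v : Fin g ⊕ Fin g → ℤ) (t : ZMod m) : Γ := q (S u v (t.cast : ℤ))

/-- The reduction of an integral vector. -/
def vred (m : ℕ) (v : Fin g ⊕ Fin g → ℤ) : Fin g ⊕ Fin g → ZMod m :=
  fun i => (v i : ZMod m)

lemma reduce_S {u v : Fin g ⊕ Fin g → ℤ} (k : ℤ) :
    reduce g m (S u v k) = S (vred m u) (vred m v) (k : ZMod m) := by
  have h : vred m (u + v) = vred m u + vred m v := by funext i; simp [vred]
  simp only [S, map_mul, reduce_T, Int.cast_neg, ← h]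
  rfl

lemma sform_vred (u v : Fin g ⊕ Fin g → ℤ) :
    sform (vred m u) (vred m v) = ((sform u v : ℤ) : ZMod m) :=
  sform_map (Int.castRingHom (ZMod m)) u v

lemma reduce_smul_vred (A : Sp g ℤ) (v : Fin g ⊕ Fin g → ℤ) :
    reduce g m A • vred m v = vred m (A • v) :=
  map_smul_comp (Int.castRingHom (ZMod m)) A v

namespace KillsLevel

variable {q : Sp g ℤ →* Γ} (hq : KillsLevel m q)
include hq

lemma T_congr (v : Fin g ⊕ Fin g → ℤ) {k l : ℤ} (h : (k : ZMod m) = l) :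
    q (T v k) = q (T v l) := by
  obtain ⟨c, hc⟩ := (ZMod.intCast_eq_intCast_iff_dvd_sub _ _ _).1 h
  have : l = k + c * m := by linear_combination hc
  rw [this, T_add, map_mul, ← Int.cast_id (n := c), ← T_zpow, map_zpow, hq.T_eq_one,
    _root_.one_zpow, mul_one]

lemma S_congr (u v : Fin g ⊕ Fin g → ℤ) {k l : ℤ} (h : (k : ZMod m) = l) :
    q (S u v k) = q (S u v l) := by
  have h' : ((-k : ℤ) : ZMod m) = ((-l : ℤ) : ZMod m) := by push_cast; rw [h]
  simp only [S, map_mul, hq.T_congr _ h, hq.T_congr _ h']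

lemma q_T (v : Fin g ⊕ Fin g → ℤ) (k : ℤ) : q (T v k) = tv q v (k : ZMod m) :=
  hq.T_congr v (by simp)

lemma q_S (u v : Fin g ⊕ Fin g → ℤ) (k : ℤ) : q (S u v k) = sv q u v (k : ZMod m) :=
  hq.S_congr u v (by simp)

lemma tv_add (v : Fin g ⊕ Fin g → ℤ) (s t : ZMod m) :
    tv q v (s + t) = tv q v s * tv q v t := by
  obtain ⟨s, rfl⟩ := ZMod.intCast_surjective s
  obtain ⟨t, rfl⟩ := ZMod.intCast_surjective t
  rw [← Int.cast_add, ← hq.q_T, ← hq.q_T, ← hq.q_T, T_add, map_mul]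

lemma sv_add {u v : Fin g ⊕ Fin g → ℤ} (h : sform u v = 0) (s t : ZMod m) :
    sv q u v (s + t) = sv q u v s * sv q u v t := by
  obtain ⟨s, rfl⟩ := ZMod.intCast_surjective s
  obtain ⟨t, rfl⟩ := ZMod.intCast_surjective t
  rw [← Int.cast_add, ← hq.q_S, ← hq.q_S, ← hq.q_S, S_add h, map_mul]

lemma tv_zero (v : Fin g ⊕ Fin g → ℤ) : tv q v (0 : ZMod m) = 1 := by
  rw [← Int.cast_zero, ← hq.q_T, T_zero, map_one]

lemma sv_zero (u v : Fin g ⊕ Fin g → ℤ) : sv q u v (0 : ZMod m) = 1 := by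
  rw [← Int.cast_zero, ← hq.q_S, S_zero, map_one]

lemma tv_neg (v : Fin g ⊕ Fin g → ℤ) (t : ZMod m) : tv q v (-t) = (tv q v t)⁻¹ :=
  eq_inv_of_mul_eq_one_left (by rw [← hq.tv_add, neg_add_cancel, hq.tv_zero])

lemma sv_neg {u v : Fin g ⊕ Fin g → ℤ} (h : sform u v = 0) (t : ZMod m) :
    sv q u v (-t) = (sv q u v t)⁻¹ :=
  eq_inv_of_mul_eq_one_left (by rw [← hq.sv_add h, neg_add_cancel, hq.sv_zero])

lemma tv_smul_vec (c : ℤ) (v : Fin g ⊕ Fin g → ℤ) (t : ZMod m) :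
    tv q (c • v) t = tv q v ((c : ZMod m) ^ 2 * t) := by
  obtain ⟨t, rfl⟩ := ZMod.intCast_surjective t
  rw [← hq.q_T, T_smul_vec, hq.q_T]
  push_cast
  rfl

lemma sv_smul_vec {u v : Fin g ⊕ Fin g → ℤ} (h : sform u v = 0) (c d : ℤ) (t : ZMod m) :
    sv q (c • u) (d • v) t = sv q u v ((c : ZMod m) * (d : ZMod m) * t) := by
  obtain ⟨t, rfl⟩ := ZMod.intCast_surjective t
  rw [← hq.q_S, S_smul_left_vec (by rw [sform_smul_right, h, mul_zero]), S_smul_right_vec h, hq.q_S]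
  push_cast
  congr 1
  ring

/-- Expansion of a transvection along a combination of orthogonal vectors. -/
lemma tv_comb {u v : Fin g ⊕ Fin g → ℤ} (h : sform u v = 0) (a b : ℤ) (t : ZMod m) :
    tv q (a • u + b • v) t = tv q u ((a : ZMod m) ^ 2 * t) * tv q v ((b : ZMod m) ^ 2 * t) *
      sv q u v ((a : ZMod m) * (b : ZMod m) * t) := by
  have h' : sform (a • u) (b • v) = 0 := by rw [sform_smul_left, sform_smul_right, h]; ring
  rw [← hq.tv_smul_vec, ← hq.tv_smul_vec, ← hq.sv_smul_vec h]
  obtain ⟨t, rfl⟩ := ZMod.intCast_surjective t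
  rw [← hq.q_T, ← hq.q_T, ← hq.q_T, ← hq.q_S, T_add_vec h', map_mul, map_mul]

omit hq in
lemma tv_neg_vec (v : Fin g ⊕ Fin g → ℤ) (t : ZMod m) : tv q (-v) t = tv q v t := by
  rw [tv, T_neg_vec, tv]

omit hq in
lemma sv_comm {u v : Fin g ⊕ Fin g → ℤ} (h : sform u v = 0) (t : ZMod m) :
    sv q u v t = sv q v u t := by
  rw [sv, S_comm _ _ h, sv]

lemma sv_neg_left {u v : Fin g ⊕ Fin g → ℤ} (h : sform u v = 0) (t : ZMod m) :
    sv q (-u) v t = sv q u v (-t) := by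
  simpa [-zsmul_eq_mul] using hq.sv_smul_vec h (-1) 1 t

lemma sv_neg_right {u v : Fin g ⊕ Fin g → ℤ} (h : sform u v = 0) (t : ZMod m) :
    sv q u (-v) t = sv q u v (-t) := by
  simpa [-zsmul_eq_mul] using hq.sv_smul_vec h 1 (-1) t

omit hq in
lemma conj_tv (A : Sp g ℤ) (v : Fin g ⊕ Fin g → ℤ) (t : ZMod m) :
    MulAut.conj (q A) (tv q v t) = tv q (A • v) t := by
  rw [MulAut.conj_apply, tv, tv, ← conj_T, map_mul, map_mul, map_inv]

omit hq in
lemma conj_sv (A : Sp g ℤ) (u v : Fin g ⊕ Fin g → ℤ) (t : ZMod m) :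
    MulAut.conj (q A) (sv q u v t) = sv q (A • u) (A • v) t := by
  rw [MulAut.conj_apply, sv, sv, ← conj_S, map_mul, map_mul, map_inv]

omit hq in
lemma tv_commute {u v : Fin g ⊕ Fin g → ℤ} (h : sform u v = 0) (s t : ZMod m) :
    Commute (tv q u s) (tv q v t) := (T_commute h _ _).map q

omit hq in
lemma tv_commute_sv {u v w : Fin g ⊕ Fin g → ℤ} (hu : sform w u = 0) (hv : sform w v = 0)
    (s t : ZMod m) : Commute (tv q w s) (sv q u v t) := (T_commute_S hu hv _ _).map q

/-- Changing an entry by a matrix of level `m` multiplies its image by a central element, which a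
commutator does not see. Identities known only modulo `m` thus become exact in `Γ` once both sides
are commutators. -/
lemma commutator_congr {A A' B B' : Sp g ℤ} (hA : reduce g m A = reduce g m A')
    (hB : reduce g m B = reduce g m B') : ⁅q A, q B⁆ = ⁅q A', q B'⁆ := by
  have h1 : reduce g m (A'⁻¹ * A) = 1 := by rw [map_mul, map_inv, hA, inv_mul_cancel]
  have h2 : reduce g m (B'⁻¹ * B) = 1 := by rw [map_mul, map_inv, hB, inv_mul_cancel]
  have c1 : Commute (q (A'⁻¹ * A)) (q B) := hq.central _ h1 _
  have c2 : Commute (q (B'⁻¹ * B)) (q A') := hq.central _ h2 _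
  have e1 : q A = q A' * q (A'⁻¹ * A) := by rw [← map_mul, mul_inv_cancel_left]
  have e2 : q B = q B' * q (B'⁻¹ * B) := by rw [← map_mul, mul_inv_cancel_left]
  rw [commutatorElement_def, commutatorElement_def]
  calc q A * q B * (q A)⁻¹ * (q B)⁻¹
      = q A' * (q (A'⁻¹ * A) * q B) * (q (A'⁻¹ * A))⁻¹ * (q A')⁻¹ * (q B)⁻¹ := by rw [e1]; group
    _ = q A' * q B * (q A')⁻¹ * (q B)⁻¹ := by rw [c1.eq]; group
    _ = q A' * q B' * (q (B'⁻¹ * B) * (q A')⁻¹) * (q (B'⁻¹ * B))⁻¹ * (q B')⁻¹ := by rw [e2]; group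
    _ = _ := by rw [c2.inv_right.eq]; group

end KillsLevel

/-- A symplectic basis of a nondegenerate subspace of rank four. -/
structure SymplecticQuadruple (c c' d d' : Fin g ⊕ Fin g → ℤ) : Prop where
  cc' : sform c c' = 1
  dd' : sform d d' = 1
  cd : sform c d = 0
  cd' : sform c d' = 0
  c'd : sform c' d = 0
  c'd' : sform c' d' = 0

namespace SymplecticQuadruple

variable {c c' d d' : Fin g ⊕ Fin g → ℤ} (Q : SymplecticQuadruple c c' d d')
include Q

lemma swap : SymplecticQuadruple d d' c c' :=
  ⟨Q.dd', Q.cc', by rw [sform_swap, Q.cd, neg_zero], by rw [sform_swap, Q.c'd, neg_zero],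
    by rw [sform_swap, Q.cd', neg_zero], by rw [sform_swap, Q.c'd', neg_zero]⟩

lemma rotate : SymplecticQuadruple c' (-c) d d' :=
  ⟨by rw [sform_neg_right, sform_swap, Q.cc', neg_neg], Q.dd', Q.c'd, Q.c'd',
    by rw [sform_neg_left, Q.cd, neg_zero], by rw [sform_neg_left, Q.cd', neg_zero]⟩

lemma c'c : sform c' c = -1 := by rw [sform_swap, Q.cc']

lemma d'd : sform d' d = -1 := by rw [sform_swap, Q.dd']

end SymplecticQuadruple

namespace KillsLevel

variable {q : Sp g ℤ →* Γ} (hq : KillsLevel m q) {c c' d d' : Fin g ⊕ Fin g → ℤ}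
  (Q : SymplecticQuadruple c c' d d')
include hq Q

/-- The commutator formula for a long root element and a short root element. -/
lemma commutator_sv_tv (s t : ZMod m) :
    ⁅sv q c' d (-s), tv q c t⁆ = tv q d (s ^ 2 * t) * sv q c d (s * t) := by
  obtain ⟨s, rfl⟩ := ZMod.intCast_surjective s
  have h : S c' d (-s) • c = (1 : ℤ) • c + s • d := by
    rw [S_smul Q.c'd, Q.c'c, Q.swap.cd]
    module
  rw [commutatorElement_def, ← hq.tv_neg, ← Int.cast_neg, ← hq.q_S, ← MulAut.conj_apply, conj_tv, h,
    hq.tv_comb Q.cd, hq.tv_neg, (tv_commute Q.cd _ _).eq, mul_assoc (tv q d _),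
    (tv_commute_sv (sform_self c) Q.cd _ _).eq]
  simp [mul_assoc]

omit Q in
/-- Conjugation of a commutator by an element that acts diagonally modulo `m`. -/
lemma conj_commutator {A : Sp g ℤ} {x y z : Fin g ⊕ Fin g → ℤ} (hxy : sform x y = 0)
    {a b e : ZMod m} (hx : reduce g m A • vred m x = a • vred m x)
    (hy : reduce g m A • vred m y = b • vred m y) (hz : reduce g m A • vred m z = e • vred m z)
    (s t : ZMod m) :
    MulAut.conj (q A) ⁅sv q x y s, tv q z t⁆ =
      ⁅sv q x y (a * b * s), tv q z (e ^ 2 * t)⁆ := by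
  have hxy' : sform (vred m x) (vred m y) = 0 := by rw [sform_vred, hxy, Int.cast_zero]
  rw [map_commutatorElement, sv, tv, MulAut.conj_apply, MulAut.conj_apply, ← map_inv, ← map_mul,
    ← map_mul, ← map_mul, ← map_mul, sv, tv]
  apply hq.commutator_congr
  · rw [map_mul, map_mul, map_inv, reduce_S, conj_S, reduce_S, hx, hy,
      S_smul_left_vec (by rw [sform_smul_right, hxy', mul_zero]), S_smul_right_vec hxy']
    congr 1
    rw [ZMod.intCast_cast, ZMod.intCast_cast, ZMod.cast_id, ZMod.cast_id]
    ring
  · rw [map_mul, map_mul, map_inv, reduce_T, reduce_T]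
    change _ * T (vred m z) _ * _ = T (vred m z) _
    rw [conj_T, hz, T_smul_vec]
    congr 1
    rw [ZMod.intCast_cast, ZMod.intCast_cast, ZMod.cast_id, ZMod.cast_id]

/-- An element that acts diagonally modulo `m` conjugates root elements as expected. -/
lemma conj_of_reduce {A : Sp g ℤ} (hAd : ∀ t : ZMod m, Commute (q A) (tv q d t)) (u : (ZMod m)ˣ)
    (h1 : reduce g m A • vred m c = (u : ZMod m) • vred m c)
    (h2 : reduce g m A • vred m c' = ((u⁻¹ : (ZMod m)ˣ) : ZMod m) • vred m c')
    (h3 : reduce g m A • vred m d = vred m d) (h4 : reduce g m A • vred m d' = vred m d')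
    (t : ZMod m) :
    MulAut.conj (q A) (tv q c t) = tv q c ((u : ZMod m) ^ 2 * t) ∧
      MulAut.conj (q A) (sv q c d t) = sv q c d ((u : ZMod m) * t) := by
  have hd : MulAut.conj (q A) (tv q d t) = tv q d t := by
    rw [MulAut.conj_apply, (hAd t).eq, mul_inv_cancel_right]
  replace h3 : reduce g m A • vred m d = (1 : ZMod m) • vred m d := by rw [one_smul, h3]
  replace h4 : reduce g m A • vred m d' = (1 : ZMod m) • vred m d' := by rw [one_smul, h4]
  have hu : ((u⁻¹ : (ZMod m)ˣ) : ZMod m) * u = 1 := u.inv_mul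
  -- The commutator formula writes `tv d * sv c d` as a commutator. The factor at `d` is fixed by
  -- hypothesis, which determines the action on the short root element.
  have e1 := hq.conj_commutator Q.c'd h2 h3 h1 (-1) t
  rw [show ((u⁻¹ : (ZMod m)ˣ) : ZMod m) * 1 * -1 = -((u⁻¹ : (ZMod m)ˣ) : ZMod m) by ring,
    hq.commutator_sv_tv Q, hq.commutator_sv_tv Q, map_mul] at e1
  generalize ((u⁻¹ : (ZMod m)ˣ) : ZMod m) = v at *
  rw [show v ^ 2 * ((u : ZMod m) ^ 2 * t) = t by
      linear_combination (v * u * t + t) * hu,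
    show v * ((u : ZMod m) ^ 2 * t) = u * t by linear_combination (u * t) * hu,
    one_pow, one_mul, hd, mul_right_inj] at e1
  refine ⟨?_, e1⟩
  -- The same formula with the two planes exchanged has `tv c` as its long root factor, and the
  -- short root factor is now known.
  have e2 := hq.conj_commutator Q.swap.c'd h4 h1 h3 (-1) t
  rw [show 1 * (u : ZMod m) * -1 = -(u : ZMod m) by ring, hq.commutator_sv_tv Q.swap,
    hq.commutator_sv_tv Q.swap, map_mul, one_pow, one_mul, sv_comm Q.swap.cd,
    sv_comm Q.swap.cd, e1, mul_left_inj] at e2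
  exact e2

end KillsLevel

end Sp

/-! ### Weyl elements, torus elements and symbols -/

namespace Sp

variable {g m : ℕ} {Γ : Type} [Group Γ]

section Weyl

variable {R : Type} [CommRing R] {c c' : Fin g ⊕ Fin g → R}

lemma weyl_smul_left (h : sform c c' = 1) {u u' : R} (hu : u * u' = 1) :
    (T c u * T c' u' * T c u) • c = -u' • c' := by
  have h' : sform c' c = -1 := by rw [sform_swap, h]
  simp only [mul_smul, T_smul, sform_add_right, sform_smul_right, sform_self, h, h']
  linear_combination (norm := module) (-hu) • c

lemma weyl_smul_right (h : sform c c' = 1) {u u' : R} (hu : u * u' = 1) :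
    (T c u * T c' u' * T c u) • c' = u • c := by
  have h' : sform c' c = -1 := by rw [sform_swap, h]
  simp only [mul_smul, T_smul, sform_add_right, sform_smul_right, sform_self, h, h']
  linear_combination (norm := module) (-hu) • c' + (-u * hu) • c

lemma weyl_smul_of_orth {z : Fin g ⊕ Fin g → R} (h : sform c z = 0) (h' : sform c' z = 0)
    (u u' : R) : (T c u * T c' u' * T c u) • z = z := by
  rw [mul_smul, mul_smul, T_smul_of_sform_eq_zero h, T_smul_of_sform_eq_zero h',
    T_smul_of_sform_eq_zero h]

lemma ext_pair (h : sform c c' = 1) {A B : Sp g R} (h1 : A • c = B • c) (h2 : A • c' = B • c')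
    (h3 : ∀ z, sform c z = 0 → sform c' z = 0 → A • z = B • z) : A = B := by
  have hs (C : Sp g R) (k : R) (y : Fin g ⊕ Fin g → R) : C • k • y = k • C • y := smul_comm C k y
  refine ext_smul fun x => ?_
  have hz := h3 (x - (sform x c' • c + sform c x • c'))
    (by simp [h])
    (by simp [sform_swap c' c, h, sform_swap c' x])
  have hx : x = (x - (sform x c' • c + sform c x • c')) +
      (sform x c' • c + sform c x • c') := by abel
  rw [hx, smul_add, smul_add, hz]
  simp only [smul_add, hs, h1, h2]

end Weyl

/-- The image in `Γ` of a Weyl element of a long root. -/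
def Wt (q : Sp g ℤ →* Γ) (c c' : Fin g ⊕ Fin g → ℤ) (u : (ZMod m)ˣ) : Γ :=
  tv q c (u : ZMod m) * tv q c' ((u⁻¹ : (ZMod m)ˣ) : ZMod m) * tv q c (u : ZMod m)

/-- The image in `Γ` of a torus element of a long root. -/
def ht (q : Sp g ℤ →* Γ) (c c' : Fin g ⊕ Fin g → ℤ) (u : (ZMod m)ˣ) : Γ :=
  Wt q c c' u * (Wt q c c' (1 : (ZMod m)ˣ))⁻¹

/-- An integral lift of `Wt`. -/
def WG (c c' : Fin g ⊕ Fin g → ℤ) (u : (ZMod m)ˣ) : Sp g ℤ :=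
  T c ((u : ZMod m).cast : ℤ) * T c' (((u⁻¹ : (ZMod m)ˣ) : ZMod m).cast : ℤ) *
    T c ((u : ZMod m).cast : ℤ)

/-- An integral lift of `ht`. -/
def HG (c c' : Fin g ⊕ Fin g → ℤ) (u : (ZMod m)ˣ) : Sp g ℤ :=
  WG c c' u * (WG c c' (1 : (ZMod m)ˣ))⁻¹

lemma q_WG (q : Sp g ℤ →* Γ) (c c' : Fin g ⊕ Fin g → ℤ) (u : (ZMod m)ˣ) :
    q (WG c c' u) = Wt q c c' u := by
  rw [WG, map_mul, map_mul]; rfl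

lemma q_HG (q : Sp g ℤ →* Γ) (c c' : Fin g ⊕ Fin g → ℤ) (u : (ZMod m)ˣ) :
    q (HG c c' u) = ht q c c' u := by
  rw [HG, map_mul, map_inv, q_WG, q_WG]; rfl

section Reduce

variable {c c' : Fin g ⊕ Fin g → ℤ} (h : sform c c' = 1) (u : (ZMod m)ˣ)

lemma reduce_WG (c c' : Fin g ⊕ Fin g → ℤ) : reduce g m (WG c c' u) =
    T (vred m c) (u : ZMod m) * T (vred m c') ((u⁻¹ : (ZMod m)ˣ) : ZMod m) *
      T (vred m c) (u : ZMod m) := by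
  rw [WG, map_mul, map_mul, reduce_T, reduce_T]
  simp only [ZMod.intCast_cast, ZMod.cast_id]
  rfl

include h

lemma sform_vred_one : sform (vred m c) (vred m c') = 1 := by rw [sform_vred, h, Int.cast_one]

lemma reduce_HG_left : reduce g m (HG c c' u) • vred m c = (u : ZMod m) • vred m c := by
  have h1 : (reduce g m (WG c c' (1 : (ZMod m)ˣ)))⁻¹ • vred m c = vred m c' := by
    rw [inv_smul_eq_iff, reduce_WG, weyl_smul_right (sform_vred_one h) (by simp)]; simp
  rw [HG, map_mul, map_inv, mul_smul, h1, reduce_WG,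
    weyl_smul_right (sform_vred_one h) (by simp)]

lemma reduce_HG_right : reduce g m (HG c c' u) • vred m c' =
    ((u⁻¹ : (ZMod m)ˣ) : ZMod m) • vred m c' := by
  have h1 : (reduce g m (WG c c' (1 : (ZMod m)ˣ)))⁻¹ • vred m c' = -vred m c := by
    rw [inv_smul_eq_iff, reduce_WG, smul_neg,
      weyl_smul_left (sform_vred_one h) (by simp)]; simp
  rw [HG, map_mul, map_inv, mul_smul, h1, reduce_WG, smul_neg,
    weyl_smul_left (sform_vred_one h) (by simp)]
  simp

omit h in
lemma reduce_HG_of_orth {z : Fin g ⊕ Fin g → ZMod m} (h1 : sform (vred m c) z = 0)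
    (h2 : sform (vred m c') z = 0) : reduce g m (HG c c' u) • z = z := by
  have h3 : (reduce g m (WG c c' (1 : (ZMod m)ˣ)))⁻¹ • z = z := by
    rw [inv_smul_eq_iff, reduce_WG, weyl_smul_of_orth h1 h2]
  rw [HG, map_mul, map_inv, mul_smul, h3, reduce_WG, weyl_smul_of_orth h1 h2]

lemma reduce_HG_mul (u v : (ZMod m)ˣ) :
    reduce g m (HG c c' u * HG c c' v * (HG c c' (u * v))⁻¹) = 1 := by
  have hs (C : Sp g (ZMod m)) (k : ZMod m) (y : Fin g ⊕ Fin g → ZMod m) :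
    C • k • y = k • C • y := smul_comm C k y
  rw [map_mul, map_inv, mul_inv_eq_one, map_mul]
  refine ext_pair (sform_vred_one h) ?_ ?_ fun z h1 h2 => ?_
  · rw [mul_smul, reduce_HG_left h, reduce_HG_left h, hs, reduce_HG_left h, smul_smul, mul_comm,
      Units.val_mul]
  · rw [mul_smul, reduce_HG_right h, reduce_HG_right h, hs, reduce_HG_right h, smul_smul,
      _root_.mul_inv_rev, Units.val_mul]
  · rw [mul_smul, reduce_HG_of_orth _ h1 h2, reduce_HG_of_orth _ h1 h2, reduce_HG_of_orth _ h1 h2]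

end Reduce

namespace KillsLevel

variable {q : Sp g ℤ →* Γ} (hq : KillsLevel m q)
include hq

section Quadruple

variable {c c' d d' : Fin g ⊕ Fin g → ℤ} (Q : SymplecticQuadruple c c' d d')
include Q

omit hq Q in
lemma Wt_commute_tv {z : Fin g ⊕ Fin g → ℤ} (h1 : sform c z = 0) (h2 : sform c' z = 0)
    (u : (ZMod m)ˣ) (t : ZMod m) : Commute (Wt q c c' u) (tv q z t) :=
  ((tv_commute h1 _ _).mul_left (tv_commute h2 _ _)).mul_left (tv_commute h1 _ _)

omit hq Q in
lemma ht_commute_tv {z : Fin g ⊕ Fin g → ℤ} (h1 : sform c z = 0) (h2 : sform c' z = 0)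
    (u : (ZMod m)ˣ) (t : ZMod m) : Commute (ht q c c' u) (tv q z t) :=
  (Wt_commute_tv h1 h2 u t).mul_left (Wt_commute_tv h1 h2 1 t).inv_left

omit hq in
lemma Wt_commute_Wt (u v : (ZMod m)ˣ) : Commute (Wt q c c' u) (Wt q d d' v) :=
  ((Wt_commute_tv Q.cd Q.c'd _ _).mul_right (Wt_commute_tv Q.cd' Q.c'd' _ _)).mul_right
    (Wt_commute_tv Q.cd Q.c'd _ _)

omit hq in
lemma ht_commute_Wt (u v : (ZMod m)ˣ) : Commute (ht q c c' u) (Wt q d d' v) :=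
  (Wt_commute_Wt Q u v).mul_left (Wt_commute_Wt Q 1 v).inv_left

omit hq in
lemma ht_commute_ht' (u v : (ZMod m)ˣ) : Commute (ht q c c' u) (ht q d d' v) :=
  (ht_commute_Wt Q u v).mul_right (ht_commute_Wt Q u 1).inv_right

/-- The integral lift `HG` is diagonal modulo `m`, so `conj_of_reduce` applies, once to the given
quadruple and once to its rotation, where `u` becomes `u⁻¹`. -/
lemma conj_ht_aux (u : (ZMod m)ˣ) (t : ZMod m) :
    (MulAut.conj (ht q c c' u) (tv q c t) = tv q c ((u : ZMod m) ^ 2 * t) ∧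
      MulAut.conj (ht q c c' u) (sv q c d t) = sv q c d ((u : ZMod m) * t)) ∧
    (MulAut.conj (ht q c c' u) (tv q c' t) = tv q c' (((u⁻¹ : (ZMod m)ˣ) : ZMod m) ^ 2 * t) ∧
      MulAut.conj (ht q c c' u) (sv q c' d t) =
        sv q c' d (((u⁻¹ : (ZMod m)ˣ) : ZMod m) * t)) := by
  have hcomm : ∀ t : ZMod m, Commute (q (HG c c' u)) (tv q d t) := fun t => by
    rw [q_HG]; exact ht_commute_tv Q.cd Q.c'd u t
  have h3 : reduce g m (HG c c' u) • vred m d = vred m d := reduce_HG_of_orth _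
    (by rw [sform_vred, Q.cd, Int.cast_zero]) (by rw [sform_vred, Q.c'd, Int.cast_zero])
  have h4 : reduce g m (HG c c' u) • vred m d' = vred m d' := reduce_HG_of_orth _
    (by rw [sform_vred, Q.cd', Int.cast_zero]) (by rw [sform_vred, Q.c'd', Int.cast_zero])
  have h1 := reduce_HG_left Q.cc' u
  have h2 := reduce_HG_right Q.cc' u
  have hn : vred m (-c) = -vred m c := by funext i; simp [vred]
  rw [← q_HG]
  refine ⟨hq.conj_of_reduce Q hcomm u h1 h2 h3 h4 t,
    hq.conj_of_reduce Q.rotate hcomm u⁻¹ h2 ?_ h3 h4 t⟩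
  rw [inv_inv, hn, smul_neg, h1, smul_neg]

lemma conj_ht_tv (u : (ZMod m)ˣ) (t : ZMod m) :
    MulAut.conj (ht q c c' u) (tv q c t) = tv q c ((u : ZMod m) ^ 2 * t) :=
  (hq.conj_ht_aux Q u t).1.1

lemma conj_ht_tv' (u : (ZMod m)ˣ) (t : ZMod m) :
    MulAut.conj (ht q c c' u) (tv q c' t) = tv q c' (((u⁻¹ : (ZMod m)ˣ) : ZMod m) ^ 2 * t) :=
  (hq.conj_ht_aux Q u t).2.1

lemma conj_ht_sv (u : (ZMod m)ˣ) (t : ZMod m) :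
    MulAut.conj (ht q c c' u) (sv q c d t) = sv q c d ((u : ZMod m) * t) :=
  (hq.conj_ht_aux Q u t).1.2

lemma conj_ht_sv' (u : (ZMod m)ˣ) (t : ZMod m) :
    MulAut.conj (ht q c c' u) (sv q c' d t) = sv q c' d (((u⁻¹ : (ZMod m)ˣ) : ZMod m) * t) :=
  (hq.conj_ht_aux Q u t).2.2

omit Q in
lemma Wt_one : Wt q c c' (1 : (ZMod m)ˣ) = q (T c 1 * T c' 1 * T c 1) := by
  rw [map_mul, map_mul, hq.q_T, hq.q_T]
  simp [Wt]

lemma conj_Wt_one_tv (t : ZMod m) :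
    MulAut.conj (Wt q c c' (1 : (ZMod m)ˣ)) (tv q c t) = tv q c' t := by
  rw [hq.Wt_one, conj_tv, weyl_smul_left Q.cc' (one_mul 1), neg_one_smul, tv_neg_vec]

lemma conj_Wt_one_tv' (t : ZMod m) :
    MulAut.conj (Wt q c c' (1 : (ZMod m)ˣ)) (tv q c' t) = tv q c t := by
  rw [hq.Wt_one, conj_tv, weyl_smul_right Q.cc' (one_mul 1), one_smul]

lemma Wt_one_pow_four :
    Wt q c c' (1 : (ZMod m)ˣ) * Wt q c c' (1 : (ZMod m)ˣ) *
      (Wt q c c' (1 : (ZMod m)ˣ) * Wt q c c' (1 : (ZMod m)ˣ)) = 1 := by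
  rw [hq.Wt_one, ← map_mul, ← map_mul, ← map_one q]
  congr 1
  have h1 := weyl_smul_left Q.cc' (one_mul (1 : ℤ))
  have h2 := weyl_smul_right Q.cc' (one_mul (1 : ℤ))
  rw [one_smul] at h2
  rw [neg_one_smul] at h1
  have h5 (z) (h3 : sform c z = 0) (h4 : sform c' z = 0) := weyl_smul_of_orth h3 h4 (1 : ℤ) 1
  generalize T c 1 * T c' 1 * T c 1 = w at *
  refine ext_pair Q.cc' ?_ ?_ fun z h3 h4 => ?_
  · simp only [mul_smul, h1, h2, smul_neg, neg_neg, one_smul]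
  · simp only [mul_smul, h1, h2, smul_neg, neg_neg, one_smul]
  · simp only [mul_smul, h5 z h3 h4, one_smul]

lemma conj_ht_Wt (u v : (ZMod m)ˣ) :
    MulAut.conj (ht q c c' u) (Wt q c c' v) = Wt q c c' (u ^ 2 * v) := by
  have h : (u ^ 2 * v)⁻¹ = u⁻¹ ^ 2 * v⁻¹ := by rw [_root_.mul_inv, inv_pow]
  simp only [Wt, map_mul, hq.conj_ht_tv Q, hq.conj_ht_tv' Q, h, Units.val_mul,
    Units.val_pow_eq_pow_val]

omit Q in
/-- The symbol `{u, v}` is central in the image. -/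
lemma symbol_commute (Q : SymplecticQuadruple c c' d d') (u v : (ZMod m)ˣ) (B : Sp g ℤ) :
    Commute (ht q c c' u * ht q c c' v * (ht q c c' (u * v))⁻¹) (q B) := by
  have := hq.central _ (reduce_HG_mul Q.cc' u v) B
  rwa [map_mul, map_mul, map_inv, q_HG, q_HG, q_HG] at this

/-- Conjugating `Wt c c' u` by the Weyl element at `1`, and conjugating `Wt c c' u⁻¹` by itself,
both give `Wt c' c u`. -/
lemma conj_Wt_Wt_one (u : (ZMod m)ˣ) :
    MulAut.conj (Wt q c c' (1 : (ZMod m)ˣ)) (Wt q c c' u) = Wt q c c' u⁻¹ := by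
  have h1 : MulAut.conj (Wt q c c' (1 : (ZMod m)ˣ)) (Wt q c c' u) = Wt q c' c u := by
    change MulAut.conj _ (tv q c _ * tv q c' _ * tv q c _) = tv q c' _ * tv q c _ * tv q c' _
    simp only [map_mul, hq.conj_Wt_one_tv Q, hq.conj_Wt_one_tv' Q]
  have h2 : Wt q c c' u⁻¹ = ht q c c' u⁻¹ * Wt q c c' (1 : (ZMod m)ˣ) := by rw [ht]; group
  have h3 : MulAut.conj (Wt q c c' u⁻¹) (Wt q c c' u⁻¹) = Wt q c' c u := by
    have h4 : MulAut.conj (Wt q c c' u⁻¹) = MulAut.conj (ht q c c' u⁻¹) *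
        MulAut.conj (Wt q c c' (1 : (ZMod m)ˣ)) := by rw [← map_mul, ← h2]
    rw [h4, MulAut.mul_apply]
    have a1 : (u : ZMod m) ^ 2 * ((u⁻¹ : (ZMod m)ˣ) : ZMod m) = u := by
      rw [pow_two, mul_assoc, Units.mul_inv, mul_one]
    have a2 : ((u⁻¹ : (ZMod m)ˣ) : ZMod m) ^ 2 * u = ((u⁻¹ : (ZMod m)ˣ) : ZMod m) := by
      rw [pow_two, mul_assoc, Units.inv_mul, mul_one]
    change MulAut.conj _ (MulAut.conj _ (tv q c _ * tv q c' _ * tv q c _)) =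
      tv q c' _ * tv q c _ * tv q c' _
    simp only [map_mul, hq.conj_Wt_one_tv Q, hq.conj_Wt_one_tv' Q,
      hq.conj_ht_tv Q, hq.conj_ht_tv' Q, inv_inv, a1, a2]
  rw [h1, ← h3, MulAut.conj_apply, mul_inv_cancel_right]

lemma conj_Wt_ht_one (u : (ZMod m)ˣ) :
    MulAut.conj (Wt q c c' (1 : (ZMod m)ˣ)) (ht q c c' u) = ht q c c' u⁻¹ := by
  rw [ht, map_mul, map_inv, hq.conj_Wt_Wt_one Q, hq.conj_Wt_Wt_one Q, inv_one, ht]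

omit hq Q in
lemma ht_one : ht q c c' (1 : (ZMod m)ˣ) = 1 := by rw [ht, mul_inv_cancel]

omit Q in
lemma Wt_neg (u : (ZMod m)ˣ) : Wt q c c' (-u) = (Wt q c c' u)⁻¹ := by
  simp only [Wt, inv_neg, Units.val_neg, hq.tv_neg]
  group

omit Q in
lemma ht_neg_one : ht q c c' (-1 : (ZMod m)ˣ) =
    (Wt q c c' (1 : (ZMod m)ˣ))⁻¹ * (Wt q c c' (1 : (ZMod m)ˣ))⁻¹ := by
  rw [ht, hq.Wt_neg]

/-- The torus element at `-1` is the inverse square of the Weyl element at `1`, and conjugating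
twice by the latter inverts `u` twice. -/
lemma ht_neg_one_commute (u : (ZMod m)ˣ) : Commute (ht q c c' (-1 : (ZMod m)ˣ)) (ht q c c' u) := by
  have h : Commute (Wt q c c' (1 : (ZMod m)ˣ) * Wt q c c' (1 : (ZMod m)ˣ)) (ht q c c' u) := by
    rw [Commute, SemiconjBy, ← mul_inv_eq_iff_eq_mul, ← MulAut.conj_apply, map_mul,
      MulAut.mul_apply, hq.conj_Wt_ht_one Q, hq.conj_Wt_ht_one Q, inv_inv]
  rw [hq.ht_neg_one, ← _root_.mul_inv_rev]
  exact h.inv_left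

end Quadruple

end KillsLevel

end Sp

/-! ### Units modulo powers of two -/

section UnitsTwoPow

lemma ZMod.isLocalRing_two_pow {n : ℕ} (hn : n ≠ 0) : IsLocalRing (ZMod (2 ^ n)) := by
  have : Fact (1 < 2 ^ n) := ⟨Nat.one_lt_two_pow hn⟩
  have key (a : ℕ) (ha : Odd a) : IsUnit (a : ZMod (2 ^ n)) :=
    (ZMod.isUnit_iff_coprime _ _).2 ((Nat.coprime_two_right.2 ha).pow_right n)
  refine IsLocalRing.of_isUnit_or_isUnit_one_sub_self fun a => ?_
  obtain ⟨a, rfl⟩ := ZMod.natCast_zmod_surjective a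
  rcases Nat.even_or_odd a with ha | ha
  · right
    have h : Odd (a + 2 ^ n - 1) := by
      obtain ⟨k, rfl⟩ := Nat.exists_eq_succ_of_ne_zero hn
      obtain ⟨b, rfl⟩ := ha
      have := Nat.one_le_two_pow (n := k)
      exact ⟨b + 2 ^ k - 1, by rw [pow_succ]; omega⟩
    have h2 := (key _ h).neg
    rw [Nat.cast_sub (by have := Nat.one_le_two_pow (n := n); omega), Nat.cast_add,
      ZMod.natCast_self] at h2
    simpa using h2
  · exact Or.inl (key a ha)

/-- The unit `5` modulo a power of two. -/
def ZMod.five (n : ℕ) : (ZMod (2 ^ n))ˣ :=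
  ZMod.unitOfCoprime 5 (Nat.Coprime.pow_right n (by norm_num))

lemma ZMod.coe_five (n : ℕ) : (ZMod.five n : ZMod (2 ^ n)) = 5 := by
  simp [ZMod.five, ZMod.coe_unitOfCoprime]

lemma ZMod.exists_eq_five_pow (n : ℕ) (u : (ZMod (2 ^ n))ˣ) :
    ∃ k : ℕ, u = ZMod.five n ^ k ∨ u = -ZMod.five n ^ k := by
  match n, u with
  | 0, u => exact ⟨0, Or.inl (Subsingleton.elim (α := (ZMod 1)ˣ) _ _)⟩
  | 1, u => exact ⟨0, Or.inl (by revert u; decide)⟩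
  | n + 2, u =>
    set F := ZMod.five (n + 2)
    have hF : orderOf F = 2 ^ n := by
      rw [← orderOf_units, ZMod.coe_five, ZMod.orderOf_five]
    have hi : (Subgroup.zpowers F).index = 2 := by
      have h1 := (Subgroup.zpowers F).card_mul_index
      rw [Nat.card_zpowers, hF, Nat.card_eq_fintype_card, ZMod.card_units_eq_totient,
        Nat.totient_prime_pow Nat.prime_two (by omega)] at h1
      have h2 : 0 < 2 ^ n := by positivity
      refine Nat.eq_of_mul_eq_mul_left h2 (h1.trans ?_)
      rw [show n + 2 - 1 = n + 1 by omega, pow_succ]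
      omega
    -- Powers of `5` are `1` modulo `4`. Since they have index two, `-1` represents the other coset.
    have hneg : (-1 : (ZMod (2 ^ (n + 2)))ˣ) ∉ Subgroup.zpowers F := by
      intro h
      obtain ⟨k, hk⟩ := (mem_powers_iff_mem_zpowers.2 h)
      have hd : 4 ∣ 2 ^ (n + 2) := ⟨2 ^ n, by ring⟩
      have h5 := congrArg (fun x : (ZMod (2 ^ (n + 2)))ˣ => ZMod.castHom hd (ZMod 4) x) hk
      simp only [Units.val_pow_eq_pow_val, F, ZMod.coe_five, map_pow, Units.val_neg, Units.val_one,
        map_neg, map_one, map_ofNat] at h5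
      rw [show (5 : ZMod 4) = 1 by decide, _root_.one_pow] at h5
      revert h5
      decide
    have h1 := Subgroup.mul_mem_iff_of_index_two hi (a := -1) (b := u)
    by_cases hu : u ∈ Subgroup.zpowers F
    · obtain ⟨k, hk⟩ := (mem_powers_iff_mem_zpowers.2 hu)
      exact ⟨k, Or.inl hk.symm⟩
    · obtain ⟨k, hk⟩ := (mem_powers_iff_mem_zpowers.2 (h1.2 (iff_of_false hneg hu)))
      exact ⟨k, Or.inr (by rw [show F ^ k = -1 * u from hk]; simp)⟩

end UnitsTwoPow

/-! ### Equivariance of the normal form under all elementary matrices -/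

section NormalForm

variable {R Γ : Type} [CommRing R] [Group Γ]

lemma upperE_add (s t : R) : upperE (s + t) = upperE s * upperE t := by
  ext i j
  rw [Matrix.SpecialLinearGroup.coe_mul]
  fin_cases i <;> fin_cases j <;> simp [upperE, Matrix.mul_apply, Fin.sum_univ_two, add_comm]

lemma lowerE_mul_weylE (t : R) : lowerE t * weylE = weylE * upperE (-t) := by
  ext i j
  rw [Matrix.SpecialLinearGroup.coe_mul, Matrix.SpecialLinearGroup.coe_mul]
  fin_cases i <;> fin_cases j <;>
    simp [upperE, lowerE, weylE, Matrix.mul_apply, Fin.sum_univ_two]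

namespace SteinbergPair

variable [IsLocalRing R] {x y : R → Γ} {h : Rˣ → Γ} {w : Γ} (P : SteinbergPair x y h w)
  (hR : ∀ t : R, ∃ k : ℕ, t = k)
include P hR

lemma normalForm_mul_upperE (A : SpecialLinearGroup (Fin 2) R) (t : R) :
    P.normalForm (A * upperE t) = P.normalForm A * x t := by
  obtain ⟨k, rfl⟩ := hR t
  induction k with
  | zero =>
    have : upperE (0 : R) = 1 := by simpa using upperE_add (0 : R) 0
    simp [this, P.x_zero]
  | succ k ih =>
    rw [Nat.cast_succ, upperE_add, ← mul_assoc, P.normalForm_mul_upperE_one, ih, P.x_add, mul_assoc]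

lemma normalForm_mul_lowerE (A : SpecialLinearGroup (Fin 2) R) (t : R) :
    P.normalForm (A * lowerE t) = P.normalForm A * y t := by
  have h1 := P.normalForm_mul_weylE (A * lowerE t)
  rw [mul_assoc, lowerE_mul_weylE, ← mul_assoc, P.normalForm_mul_upperE hR, P.normalForm_mul_weylE,
    mul_assoc, P.w_x, neg_neg, ← mul_assoc] at h1
  exact (mul_right_cancel h1).symm

end SteinbergPair

end NormalForm

/-! ### Commutativity of the torus and the short root `SL₂` -/

namespace Sp

variable {g m : ℕ} {Γ : Type} [Group Γ]

lemma SymplecticQuadruple.rotate' {c c' d d' : Fin g ⊕ Fin g → ℤ}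
    (Q : SymplecticQuadruple c c' d d') : SymplecticQuadruple c c' d' (-d) := Q.swap.rotate.swap

namespace KillsLevel

variable {q : Sp g ℤ →* Γ} (hq : KillsLevel m q)
include hq

section Torus

variable {c c' d d' : Fin g ⊕ Fin g → ℤ} (Q : SymplecticQuadruple c c' d d')
include Q

lemma ht_mul_commute (u v : (ZMod m)ˣ) {B : Sp g ℤ} (hu : Commute (ht q c c' u) (q B))
    (hv : Commute (ht q c c' v) (q B)) : Commute (ht q c c' (u * v)) (q B) := by
  have h := (hq.symbol_commute Q u v B).inv_left.mul_left (hu.mul_left hv)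
  rwa [show (ht q c c' u * ht q c c' v * (ht q c c' (u * v))⁻¹)⁻¹ *
    (ht q c c' u * ht q c c' v) = ht q c c' (u * v) by group] at h

/-- Because symbols are central, `ht` is multiplicative up to central factors, so commutation need
only be tested on generators of the unit group. -/
lemma ht_commute_of_generator {F : (ZMod m)ˣ} (hF : ∀ u, ∃ k : ℕ, u = F ^ k ∨ u = -F ^ k)
    {B : Sp g ℤ} (h1 : Commute (ht q c c' F) (q B)) (h2 : Commute (ht q c c' (-1 : (ZMod m)ˣ)) (q B))
    (u : (ZMod m)ˣ) : Commute (ht q c c' u) (q B) := by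
  have h (k : ℕ) : Commute (ht q c c' (F ^ k)) (q B) := by
    induction k with
    | zero => rw [pow_zero, ht_one]; exact Commute.one_left _
    | succ k ih => rw [pow_succ]; exact hq.ht_mul_commute Q _ _ ih h1
  obtain ⟨k, rfl | rfl⟩ := hF u
  · exact h k
  · rw [← neg_one_mul]
    exact hq.ht_mul_commute Q _ _ h2 (h k)

lemma ht_commute_ht {F : (ZMod m)ˣ} (hF : ∀ u, ∃ k : ℕ, u = F ^ k ∨ u = -F ^ k)
    (u v : (ZMod m)ˣ) : Commute (ht q c c' u) (ht q c c' v) := by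
  have h1 (v : (ZMod m)ˣ) : Commute (ht q c c' F) (ht q c c' v) := by
    have := hq.ht_commute_of_generator Q hF (B := HG c c' F)
      (by rw [q_HG]) (by rw [q_HG]; exact hq.ht_neg_one_commute Q F) v
    rw [q_HG] at this
    exact this.symm
  have := hq.ht_commute_of_generator Q hF (B := HG c c' v) (by rw [q_HG]; exact h1 v)
    (by rw [q_HG]; exact hq.ht_neg_one_commute Q v) u
  rwa [q_HG] at this

/-- The torus element at `u` sends `Wt v` to `Wt (u ^ 2 * v)`, hence `ht v` to `ht (u ^ 2 * v) * (ht
(u ^ 2))⁻¹`; but the torus is commutative, so this is again `ht v`. -/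
lemma ht_sq_mul {F : (ZMod m)ˣ} (hF : ∀ u, ∃ k : ℕ, u = F ^ k ∨ u = -F ^ k)
    (u v : (ZMod m)ˣ) : ht q c c' (u ^ 2 * v) = ht q c c' (u ^ 2) * ht q c c' v := by
  have h1 := (hq.ht_commute_ht Q hF u v).eq
  rw [← mul_inv_eq_iff_eq_mul, ← MulAut.conj_apply] at h1
  have h2 : ht q c c' v = Wt q c c' (u ^ 2 * v) * (Wt q c c' (u ^ 2))⁻¹ := by
    have h3 : MulAut.conj (ht q c c' u) (Wt q c c' v * (Wt q c c' (1 : (ZMod m)ˣ))⁻¹) =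
      Wt q c c' (u ^ 2 * v) * (Wt q c c' (u ^ 2))⁻¹ := by
      rw [map_mul, map_inv, hq.conj_ht_Wt Q, hq.conj_ht_Wt Q, mul_one]
    exact h1.symm.trans h3
  rw [(hq.ht_commute_ht Q hF _ _).eq, h2, ht, ht]
  group

end Torus

omit hq in
lemma conj_Wt (A : Sp g ℤ) (c c' : Fin g ⊕ Fin g → ℤ) (u : (ZMod m)ˣ) :
    MulAut.conj (q A) (Wt q c c' u) = Wt q (A • c) (A • c') u := by
  rw [Wt, map_mul, map_mul, conj_tv, conj_tv, Wt]

omit hq in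
lemma conj_ht (A : Sp g ℤ) (c c' : Fin g ⊕ Fin g → ℤ) (u : (ZMod m)ˣ) :
    MulAut.conj (q A) (ht q c c' u) = ht q (A • c) (A • c') u := by
  rw [ht, map_mul, map_inv, conj_Wt, conj_Wt, ht]

omit hq in
lemma ht_neg_vec (c c' : Fin g ⊕ Fin g → ℤ) (u : (ZMod m)ˣ) :
    ht q (-c) (-c') u = ht q c c' u := by
  simp only [ht, Wt, tv_neg_vec]

section Short

variable {c c' d d' : Fin g ⊕ Fin g → ℤ} (Q : SymplecticQuadruple c c' d d')

/-- The Weyl element of a short root. -/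
def shortWeyl (c c' d d' : Fin g ⊕ Fin g → ℤ) : Sp g ℤ :=
  S c d' (-1) * S d c' 1 * S c d' (-1)

include Q

omit hq in
lemma shortWeyl_smul : shortWeyl c c' d d' • c = -d ∧ shortWeyl c c' d d' • d = c ∧
    shortWeyl c c' d d' • c' = -d' ∧ shortWeyl c c' d d' • d' = c' := by
  have h1 := Q.cc'
  have h2 := Q.dd'
  have h3 := Q.cd
  have h4 := Q.cd'
  have h5 := Q.c'd
  have h6 := Q.c'd'
  have h1' := Q.c'c
  have h2' := Q.d'd
  have h3' := Q.swap.cd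
  have h4' := Q.swap.c'd
  have h5' := Q.swap.cd'
  have h6' := Q.swap.c'd'
  refine ⟨?_, ?_, ?_, ?_⟩ <;>
  · simp only [shortWeyl, mul_smul, S_smul h4, S_smul h5', sform_add_right, sform_smul_right,
      sform_self, h1, h2, h3, h4, h5, h6, h1', h2', h3', h4', h5', h6']
    module

omit Q in
lemma q_shortWeyl : q (shortWeyl c c' d d') =
    sv q c d' (-1 : ZMod m) * sv q d c' (1 : ZMod m) * sv q c d' (-1 : ZMod m) := by
  rw [shortWeyl, map_mul, map_mul, hq.q_S, hq.q_S]
  simp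

omit hq in
lemma conj_shortWeyl_ht (u : (ZMod m)ˣ) :
    MulAut.conj (q (shortWeyl c c' d d')) (ht q c c' u) = ht q d d' u := by
  obtain ⟨h1, -, h3, -⟩ := shortWeyl_smul Q
  rw [conj_ht, h1, h3, ht_neg_vec]

lemma conj_ht_short (u : (ZMod m)ˣ) (t : ZMod m) :
    MulAut.conj (ht q c c' u) (sv q c d' t) = sv q c d' ((u : ZMod m) * t) ∧
    MulAut.conj (ht q c c' u) (sv q d c' t) = sv q d c' (((u⁻¹ : (ZMod m)ˣ) : ZMod m) * t) ∧
    MulAut.conj (ht q d d' u)⁻¹ (sv q c d' t) = sv q c d' ((u : ZMod m) * t) ∧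
    MulAut.conj (ht q d d' u)⁻¹ (sv q d c' t) =
      sv q d c' (((u⁻¹ : (ZMod m)ˣ) : ZMod m) * t) := by
  refine ⟨hq.conj_ht_sv Q.rotate' u t, ?_, ?_, ?_⟩
  · rw [sv_comm Q.swap.cd', sv_comm Q.swap.cd', hq.conj_ht_sv' Q]
  · rw [sv_comm Q.cd', sv_comm Q.cd', map_inv, MulAut.inv_apply, MulEquiv.symm_apply_eq,
      hq.conj_ht_sv' Q.swap, Units.inv_mul_cancel_left]
  · rw [map_inv, MulAut.inv_apply, MulEquiv.symm_apply_eq,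
      hq.conj_ht_sv Q.swap.rotate', Units.mul_inv_cancel_left]

/-- The symbols of two long roots agree. -/
lemma symbol_eq (u v : (ZMod m)ˣ) :
    ht q c c' u * ht q c c' v * (ht q c c' (u * v))⁻¹ =
      ht q d d' u * ht q d d' v * (ht q d d' (u * v))⁻¹ := by
  have h := (hq.symbol_commute Q u v (shortWeyl c c' d d')).eq
  rw [eq_comm, ← mul_inv_eq_iff_eq_mul, ← MulAut.conj_apply] at h
  rw [← h, map_mul, map_mul, map_inv, conj_shortWeyl_ht Q, conj_shortWeyl_ht Q,
    conj_shortWeyl_ht Q]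

/-- The symbols for `c` and for `d` are the same central element, so they cancel in the quotient of
the two torus elements. The short root torus is therefore multiplicative before anything is known
about the symbols themselves. -/
lemma short_mul {F : (ZMod m)ˣ} (hF : ∀ u, ∃ k : ℕ, u = F ^ k ∨ u = -F ^ k) (u v : (ZMod m)ˣ) :
    ht q c c' (u * v) * (ht q d d' (u * v))⁻¹ =
      ht q c c' u * (ht q d d' u)⁻¹ * (ht q c c' v * (ht q d d' v)⁻¹) := by
  have h1 := hq.symbol_eq Q u v
  have h2 := (hq.ht_commute_ht Q.swap hF u v).eq
  have h3 := (ht_commute_ht' (q := q) Q v u).inv_right.eq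
  have h4 := (hq.symbol_commute Q u v (HG c c' u * HG c c' v * (HG d d' u * HG d d' v)⁻¹)).eq
  simp only [map_inv, map_mul, q_HG] at h4
  set s := ht q c c' u * ht q c c' v * (ht q c c' (u * v))⁻¹ with hs
  have e1 : ht q c c' (u * v) = s⁻¹ * (ht q c c' u * ht q c c' v) := by rw [hs]; group
  have e2 : ht q d d' (u * v) = s⁻¹ * (ht q d d' u * ht q d d' v) := by rw [h1]; group
  rw [e1, e2]
  calc _ = s⁻¹ * (ht q c c' u * ht q c c' v * (ht q d d' u * ht q d d' v)⁻¹ * s) := by group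
    _ = ht q c c' u * (ht q c c' v * (ht q d d' u)⁻¹) * (ht q d d' v)⁻¹ := by rw [← h4, h2]; group
    _ = _ := by rw [h3]; group

theorem short_steinbergPair {F : (ZMod m)ˣ} (hF : ∀ u, ∃ k : ℕ, u = F ^ k ∨ u = -F ^ k) :
    SteinbergPair (fun t : ZMod m => sv q c d' (-t)) (fun t => sv q d c' (-t))
      (fun u => ht q c c' u * (ht q d d' u)⁻¹) (q (shortWeyl c c' d d')) where
  x_add s t := by rw [neg_add, hq.sv_add Q.cd']
  y_add s t := by rw [neg_add, hq.sv_add Q.swap.cd']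
  h_mul u v := hq.short_mul Q hF u v
  h_x u t := by
    rw [← mul_inv_eq_iff_eq_mul, ← MulAut.conj_apply, map_mul, MulAut.mul_apply,
      (hq.conj_ht_short Q u _).2.2.1, (hq.conj_ht_short Q u _).1]
    congr 1
    ring
  h_y u t := by
    rw [← mul_inv_eq_iff_eq_mul, ← MulAut.conj_apply, map_mul, MulAut.mul_apply,
      (hq.conj_ht_short Q u _).2.2.2, (hq.conj_ht_short Q u _).2.1]
    congr 1
    ring
  w_x t := by
    obtain ⟨h1, -, -, h4⟩ := shortWeyl_smul Q
    rw [← mul_inv_eq_iff_eq_mul, ← MulAut.conj_apply, conj_sv, h1, h4, hq.sv_neg_left Q.swap.cd']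
  w_y t := by
    obtain ⟨-, h2, h3, -⟩ := shortWeyl_smul Q
    rw [← mul_inv_eq_iff_eq_mul, ← MulAut.conj_apply, conj_sv, h2, h3, hq.sv_neg_right Q.cd']
  w_unit u := by
    have h1 : MulAut.conj (ht q c c' u) (q (shortWeyl c c' d d')) =
        sv q c d' (-(u : ZMod m)) * sv q d c' (-(-((u⁻¹ : (ZMod m)ˣ) : ZMod m))) *
          sv q c d' (-(u : ZMod m)) := by
      rw [hq.q_shortWeyl, map_mul, map_mul, (hq.conj_ht_short Q u _).1,
        (hq.conj_ht_short Q u _).2.1]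
      simp
    rw [← h1, ← conj_shortWeyl_ht Q u, MulAut.conj_apply, MulAut.conj_apply]
    group

end Short

end KillsLevel

end Sp

/-! ### Vanishing of the symbol of `5` with itself -/

namespace Sp

variable {g m : ℕ} {Γ : Type} [Group Γ]

namespace KillsLevel

variable {q : Sp g ℤ →* Γ} (hq : KillsLevel m q) {c c' d d' : Fin g ⊕ Fin g → ℤ}
  (Q : SymplecticQuadruple c c' d d')
include hq Q

omit hq in
/-- The product of the Weyl elements of two orthogonal long roots. -/
lemma Wt_mul_Wt (u v : (ZMod m)ˣ) : Wt q c c' u * Wt q d d' v =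
    tv q c (u : ZMod m) * tv q d (v : ZMod m) *
      (tv q c' ((u⁻¹ : (ZMod m)ˣ) : ZMod m) * tv q d' ((v⁻¹ : (ZMod m)ˣ) : ZMod m)) *
      (tv q c (u : ZMod m) * tv q d (v : ZMod m)) := by
  have h1 := (tv_commute (q := q) Q.cd (u : ZMod m) (v : ZMod m)).eq
  have h2 := (tv_commute (q := q) Q.c'd ((u⁻¹ : (ZMod m)ˣ) : ZMod m) (v : ZMod m)).eq
  have h3 := (tv_commute (q := q) Q.cd' (u : ZMod m) ((v⁻¹ : (ZMod m)ˣ) : ZMod m)).eq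
  simp only [Wt]
  calc _ = tv q c (u : ZMod m) * tv q c' ((u⁻¹ : (ZMod m)ˣ) : ZMod m) *
        (tv q c (u : ZMod m) * tv q d (v : ZMod m)) *
        (tv q d' ((v⁻¹ : (ZMod m)ˣ) : ZMod m) * tv q d (v : ZMod m)) := by group
    _ = tv q c (u : ZMod m) * (tv q c' ((u⁻¹ : (ZMod m)ˣ) : ZMod m) * tv q d (v : ZMod m)) *
        (tv q c (u : ZMod m) * tv q d' ((v⁻¹ : (ZMod m)ˣ) : ZMod m)) * tv q d (v : ZMod m) := by
      rw [h1]; group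
    _ = _ := by rw [h2, h3]; group

lemma conj_Wt_mul_Wt_sv (t : ZMod m) :
    MulAut.conj (Wt q c c' (1 : (ZMod m)ˣ) * Wt q d d' (1 : (ZMod m)ˣ)) (sv q d c' t) =
        sv q c d' (-t) ∧
    MulAut.conj (Wt q c c' (1 : (ZMod m)ˣ) * Wt q d d' (1 : (ZMod m)ˣ)) (sv q c d' t) =
        sv q d c' (-t) := by
  have e1 := weyl_smul_left Q.cc' (one_mul (1 : ℤ))
  have e2 := weyl_smul_right Q.cc' (one_mul (1 : ℤ))
  have e3 := weyl_smul_left Q.dd' (one_mul (1 : ℤ))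
  have e4 := weyl_smul_right Q.dd' (one_mul (1 : ℤ))
  have e5 := weyl_smul_of_orth Q.cd Q.c'd 1 1
  have e6 := weyl_smul_of_orth Q.cd' Q.c'd' 1 1
  have e7 := weyl_smul_of_orth Q.swap.cd Q.swap.c'd 1 1
  have e8 := weyl_smul_of_orth Q.swap.cd' Q.swap.c'd' 1 1
  rw [hq.Wt_one, hq.Wt_one, ← map_mul]
  generalize T c 1 * T c' 1 * T c 1 = A at *
  generalize T d 1 * T d' 1 * T d 1 = B at *
  rw [neg_one_smul] at e1 e3
  rw [one_smul] at e2 e4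
  rw [conj_sv, conj_sv, mul_smul, mul_smul, mul_smul, mul_smul, e3, e8, e2, e7, e1, e4, e5,
    smul_neg, e6, hq.sv_neg_left Q.swap.c'd, sv_comm Q.swap.c'd, hq.sv_neg_left Q.c'd,
    sv_comm Q.c'd]
  exact ⟨rfl, rfl⟩

omit Q in
-- Root elements along an isotropic plane multiply like symmetric `2 × 2` matrices under addition.
-- The hypotheses say that the two rank one matrices add up to a diagonal one.
lemma tv_comb_mul_tv_comb {u v : Fin g ⊕ Fin g → ℤ} (h : sform u v = 0) (a b a' b' : ℤ)
    {s t x y : ZMod m} (hx : (a : ZMod m) ^ 2 * s + (a' : ZMod m) ^ 2 * t = x)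
    (hy : (b : ZMod m) ^ 2 * s + (b' : ZMod m) ^ 2 * t = y)
    (hz : (a : ZMod m) * (b : ZMod m) * s + (a' : ZMod m) * (b' : ZMod m) * t = 0) :
    tv q (a • u + b • v) s * tv q (a' • u + b' • v) t = tv q u x * tv q v y := by
  have h' : sform v u = 0 := by rw [sform_swap, h, neg_zero]
  rw [← mul_one (tv q u x * tv q v y), ← hq.sv_zero u v, ← hx, ← hy, ← hz, hq.tv_comb h,
    hq.tv_comb h, hq.tv_add, hq.tv_add, hq.sv_add h]
  clear hx hy hz
  generalize (a : ZMod m) ^ 2 * s = x₁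
  generalize (b : ZMod m) ^ 2 * s = x₂
  generalize (a : ZMod m) * (b : ZMod m) * s = x₃
  generalize (a' : ZMod m) ^ 2 * t = y₁
  generalize (b' : ZMod m) ^ 2 * t = y₂
  generalize (a' : ZMod m) * (b' : ZMod m) * t = y₃
  have c1 := (tv_commute (q := q) h' x₂ y₁).eq
  have c2 := (tv_commute_sv (q := q) (sform_self u) h y₁ x₃).eq
  have c3 := (tv_commute_sv (q := q) h' (sform_self v) y₂ x₃).eq
  calc _ = tv q u x₁ * tv q v x₂ * (sv q u v x₃ * tv q u y₁) * tv q v y₂ * sv q u v y₃ := by group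
    _ = tv q u x₁ * (tv q v x₂ * tv q u y₁) * (sv q u v x₃ * tv q v y₂) * sv q u v y₃ := by
      rw [← c2]; group
    _ = _ := by rw [c1, ← c3]; group

/-- The matrix that relates the Weyl elements at parameters `1` and `5`. -/
def fiveMatrix (c c' d d' : Fin g ⊕ Fin g → ℤ) (r : ℤ) : Sp g ℤ := S d c' 2 * S c d' (-r)

omit hq in
lemma fiveMatrix_smul (r : ℤ) :
    fiveMatrix c c' d d' r • c = (1 : ℤ) • c + (-2 : ℤ) • d ∧
    fiveMatrix c c' d d' r • d = r • c + (1 - 2 * r) • d ∧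
    fiveMatrix c c' d d' r • c' = (1 - 2 * r) • c' + (-r) • d' ∧
    fiveMatrix c c' d d' r • d' = (2 : ℤ) • c' + (1 : ℤ) • d' := by
  have h1 := Q.cc'
  have h2 := Q.dd'
  have h3 := Q.cd
  have h4 := Q.cd'
  have h5 := Q.c'd
  have h6 := Q.c'd'
  have h1' := Q.c'c
  have h2' := Q.d'd
  have h3' := Q.swap.cd
  have h4' := Q.swap.c'd
  have h5' := Q.swap.cd'
  have h6' := Q.swap.c'd'
  refine ⟨?_, ?_, ?_, ?_⟩ <;>
  · simp only [fiveMatrix, mul_smul, S_smul h4, S_smul h5', sform_add_right, sform_smul_right,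
      sform_self, h1, h2, h3, h4, h5, h6, h1', h2', h3', h4', h5', h6']
    module

/-- This is the congruence of the forms `⟨1, 25⟩` and `⟨5, 5⟩` over `ℤ/m`, which rests on `5 = 1 +
4`. The first and third factors of the Weyl product carry the form, the middle factor its inverse.
-/
lemma conj_fiveMatrix {F : (ZMod m)ˣ} (hF5 : (F : ZMod m) = 5) {r : ℤ}
    (hr : (r : ZMod m) = 2 * ((F⁻¹ : (ZMod m)ˣ) : ZMod m)) :
    MulAut.conj (q (fiveMatrix c c' d d' r)) (Wt q c c' (1 : (ZMod m)ˣ) * Wt q d d' (F ^ 2)) =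
      Wt q c c' F * Wt q d d' F := by
  obtain ⟨h1, h2, h3, h4⟩ := fiveMatrix_smul Q r
  have hv : (F : ZMod m) * ((F⁻¹ : (ZMod m)ˣ) : ZMod m) = 1 := F.mul_inv
  rw [hF5] at hv
  have e1 : MulAut.conj (q (fiveMatrix c c' d d' r))
      (tv q c ((1 : (ZMod m)ˣ) : ZMod m) * tv q d ((F ^ 2 : (ZMod m)ˣ) : ZMod m)) =
      tv q c (F : ZMod m) * tv q d (F : ZMod m) := by
    rw [map_mul, conj_tv, conj_tv, h1, h2]
    refine hq.tv_comb_mul_tv_comb Q.cd _ _ _ _ ?_ ?_ ?_ <;> push_cast <;> rw [hr, hF5]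
    · linear_combination (4 * (5 * ((F⁻¹ : (ZMod m)ˣ) : ZMod m) + 1)) * hv
    · linear_combination (80 * ((F⁻¹ : (ZMod m)ˣ) : ZMod m) - 24) * hv
    · linear_combination (-40 * ((F⁻¹ : (ZMod m)ˣ) : ZMod m) + 2) * hv
  have e2 : MulAut.conj (q (fiveMatrix c c' d d' r))
      (tv q c' (((1 : (ZMod m)ˣ)⁻¹ : (ZMod m)ˣ) : ZMod m) *
        tv q d' (((F ^ 2)⁻¹ : (ZMod m)ˣ) : ZMod m)) =
      tv q c' ((F⁻¹ : (ZMod m)ˣ) : ZMod m) * tv q d' ((F⁻¹ : (ZMod m)ˣ) : ZMod m) := by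
    rw [map_mul, conj_tv, conj_tv, h3, h4, inv_one, ← inv_pow]
    refine hq.tv_comb_mul_tv_comb Q.c'd' _ _ _ _ ?_ ?_ ?_ <;> push_cast <;> rw [hr]
    · linear_combination (4 * ((F⁻¹ : (ZMod m)ˣ) : ZMod m) - 1) * hv
    · linear_combination ((F⁻¹ : (ZMod m)ˣ) : ZMod m) * hv
    · linear_combination (2 * ((F⁻¹ : (ZMod m)ˣ) : ZMod m)) * hv
  rw [Wt_mul_Wt Q, Wt_mul_Wt Q, map_mul, map_mul, e1, e2]

omit Q in
lemma q_fiveMatrix (r : ℤ) : q (fiveMatrix c c' d d' r) =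
    sv q d c' (2 : ZMod m) * sv q c d' (-(r : ZMod m)) := by
  rw [fiveMatrix, map_mul, hq.q_S, hq.q_S]
  simp

variable {F : (ZMod m)ˣ} (hF : ∀ u, ∃ k : ℕ, u = F ^ k ∨ u = -F ^ k) (hF5 : (F : ZMod m) = 5)
include hF hF5

/-- With `Ω = Wt c 1 * Wt d 1` and `Y = q (fiveMatrix) * ht d F`, the previous lemma reads `Y Ω Y⁻¹
= ht c F * ht d F * Ω`. So the product of torus elements is `Y (Ω Y Ω⁻¹)⁻¹`, where conjugation by
`Ω` exchanges the two short root groups up to sign and inverts the parameter of `ht d`. -/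
lemma ht_mul_ht_five : ht q c c' F * ht q d d' F =
    sv q d c' (2 : ZMod m) * sv q c d' (-(2 * ((F⁻¹ : (ZMod m)ˣ) : ZMod m))) *
      sv q d c' (-10 : ZMod m) * sv q c d' (2 * ((F⁻¹ : (ZMod m)ˣ) : ZMod m) ^ 2) *
      ht q d d' (F ^ 2) := by
  have hv : (F : ZMod m) * ((F⁻¹ : (ZMod m)ˣ) : ZMod m) = 1 := F.mul_inv
  obtain ⟨r, hr⟩ := ZMod.intCast_surjective (2 * ((F⁻¹ : (ZMod m)ˣ) : ZMod m))
  have h1 := hq.conj_fiveMatrix Q hF5 hr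
  have hd : MulAut.conj (ht q d d' F) (Wt q c c' (1 : (ZMod m)ˣ) * Wt q d d' (1 : (ZMod m)ˣ)) =
      Wt q c c' (1 : (ZMod m)ˣ) * Wt q d d' (F ^ 2) := by
    rw [map_mul, hq.conj_ht_Wt Q.swap, mul_one, MulAut.conj_apply,
      (ht_commute_Wt Q.swap F 1).eq, mul_inv_cancel_right]
  have hw (u : (ZMod m)ˣ) : MulAut.conj (Wt q c c' (1 : (ZMod m)ˣ) * Wt q d d' (1 : (ZMod m)ˣ))
      (ht q d d' u) = ht q d d' u⁻¹ := by
    rw [map_mul, MulAut.mul_apply, hq.conj_Wt_ht_one Q.swap, MulAut.conj_apply,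
      (ht_commute_Wt Q.swap u⁻¹ 1).symm.eq, mul_inv_cancel_right]
  have h2 : ht q c c' F * ht q d d' F * (Wt q c c' (1 : (ZMod m)ˣ) * Wt q d d' (1 : (ZMod m)ˣ)) =
      Wt q c c' F * Wt q d d' F := by
    have := (ht_commute_Wt (q := q) Q.swap F 1).eq
    calc _ = ht q c c' F * (ht q d d' F * Wt q c c' (1 : (ZMod m)ˣ)) *
          Wt q d d' (1 : (ZMod m)ˣ) := by group
      _ = _ := by rw [this, ht, ht]; group
  rw [← hd, ← MulAut.mul_apply, ← map_mul, ← h2, MulAut.conj_apply] at h1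
  have hs := hq.conj_Wt_mul_Wt_sv Q (m := m)
  generalize Wt q c c' (1 : (ZMod m)ˣ) * Wt q d d' (1 : (ZMod m)ˣ) = Ω at *
  have h3 : ht q c c' F * ht q d d' F = q (fiveMatrix c c' d d' r) * ht q d d' F *
      (MulAut.conj Ω (q (fiveMatrix c c' d d' r) * ht q d d' F))⁻¹ := by
    rw [← mul_right_cancel_iff (a := Ω), ← h1, MulAut.conj_apply]
    group
  have h4 : ht q d d' F * (ht q d d' F⁻¹)⁻¹ = ht q d d' (F ^ 2) := by
    have := hq.ht_sq_mul Q.swap hF F F⁻¹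
    rw [pow_two, mul_inv_cancel_right, ← pow_two] at this
    rw [this, mul_inv_cancel_right]
  have h5 (t : ZMod m) : ht q d d' (F ^ 2) * sv q c d' t =
      sv q c d' (((F⁻¹ : (ZMod m)ˣ) : ZMod m) ^ 2 * t) * ht q d d' (F ^ 2) := by
    have := (hq.conj_ht_short Q (F ^ 2) (((F⁻¹ : (ZMod m)ˣ) : ZMod m) ^ 2 * t)).2.2.1
    rw [MulAut.conj_apply, inv_inv, mul_assoc, inv_mul_eq_iff_eq_mul] at this
    rw [this]
    congr 2
    push_cast
    linear_combination (-t * (F * ((F⁻¹ : (ZMod m)ˣ) : ZMod m) + 1)) * hv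
  have h6 (t : ZMod m) : ht q d d' (F ^ 2) * sv q d c' t =
      sv q d c' ((F : ZMod m) ^ 2 * t) * ht q d d' (F ^ 2) := by
    have := (hq.conj_ht_short Q (F ^ 2) ((F : ZMod m) ^ 2 * t)).2.2.2
    rw [MulAut.conj_apply, inv_inv, mul_assoc, inv_mul_eq_iff_eq_mul, ← inv_pow] at this
    rw [this]
    congr 2
    push_cast
    linear_combination (-t * (F * ((F⁻¹ : (ZMod m)ˣ) : ZMod m) + 1)) * hv
  rw [h3, map_mul, hw, hq.q_fiveMatrix, map_mul, (hs _).1, (hs _).2, hr, neg_neg]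
  set f := ((F⁻¹ : (ZMod m)ˣ) : ZMod m)
  calc _ = sv q d c' (2 : ZMod m) * sv q c d' (-(2 * f)) *
        (ht q d d' F * (ht q d d' F⁻¹)⁻¹) * sv q d c' (-(2 * f)) * sv q c d' (2 : ZMod m) := by
        rw [hq.sv_neg Q.cd' 2, hq.sv_neg Q.swap.cd']; group
    _ = sv q d c' (2 : ZMod m) * sv q c d' (-(2 * f)) *
        (ht q d d' (F ^ 2) * sv q d c' (-(2 * f))) * sv q c d' (2 : ZMod m) := by rw [h4]; group
    _ = sv q d c' (2 : ZMod m) * sv q c d' (-(2 * f)) * sv q d c' ((F : ZMod m) ^ 2 * -(2 * f)) *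
        (ht q d d' (F ^ 2) * sv q c d' (2 : ZMod m)) := by rw [h6]; group
    _ = _ := by
      rw [h5, show (F : ZMod m) ^ 2 * -(2 * f) = -10 by
        rw [hF5] at hv ⊢; linear_combination -10 * hv, mul_comm (f ^ 2) 2]
      group

/-- The short root word in `ht_mul_ht_five` multiplies out in `SL₂` to the diagonal matrix of `5`,
so by the normal form it equals `ht c F * (ht d F)⁻¹`; then `ht c F` cancels. -/
theorem ht_five_sq [NeZero m] [IsLocalRing (ZMod m)] :
    ht q d d' F * ht q d d' F = ht q d d' (F ^ 2) := by
  have P := hq.short_steinbergPair Q hF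
  have hR (t : ZMod m) : ∃ k : ℕ, t = k := (ZMod.natCast_zmod_surjective t).imp fun _ h => h.symm
  have hv : (F : ZMod m) * ((F⁻¹ : (ZMod m)ˣ) : ZMod m) = 1 := F.mul_inv
  have h1 : lowerE (-2 : ZMod m) * upperE (2 * ((F⁻¹ : (ZMod m)ˣ) : ZMod m)) * lowerE 10 *
      upperE (-(2 * ((F⁻¹ : (ZMod m)ˣ) : ZMod m) ^ 2)) = diagE F := by
    rw [hF5] at hv
    ext i j
    rw [Matrix.SpecialLinearGroup.coe_mul, Matrix.SpecialLinearGroup.coe_mul,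
      Matrix.SpecialLinearGroup.coe_mul]
    simp only [upperE, lowerE, diagE]
    generalize ((F⁻¹ : (ZMod m)ˣ) : ZMod m) = f at *
    fin_cases i <;> fin_cases j <;> simp [Matrix.mul_apply, Fin.sum_univ_two, hF5]
    · linear_combination 4 * hv
    · linear_combination (-2 * f * (4 * f + 1)) * hv
    · linear_combination -8 * hv
    · linear_combination (16 * f ^ 2 - 1) * hv
  have h2 := P.normalForm_diagE F
  rw [← h1, P.normalForm_mul_upperE hR, P.normalForm_mul_lowerE hR, P.normalForm_mul_upperE hR,
    ← one_mul (lowerE _), P.normalForm_mul_lowerE hR, P.normalForm_one, one_mul, neg_neg,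
    neg_neg] at h2
  have h3 := hq.ht_mul_ht_five Q hF hF5
  rw [h2] at h3
  have h4 : ht q d d' F = (ht q d d' F)⁻¹ * ht q d d' (F ^ 2) := by
    rw [← mul_right_inj (ht q c c' F), h3, mul_assoc]
  rwa [eq_inv_mul_iff_mul_eq] at h4

end KillsLevel

end Sp

/-! ### Multiplicativity of the long root torus and the kernel in one plane -/

namespace Sp

variable {g m : ℕ} {Γ : Type} [Group Γ]

namespace KillsLevel

variable {q : Sp g ℤ →* Γ} (hq : KillsLevel m q) {c c' d d' : Fin g ⊕ Fin g → ℤ}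
  (Q : SymplecticQuadruple c c' d d')
include hq Q

lemma ht_mul_ht_inv {F : (ZMod m)ˣ} (hF : ∀ u, ∃ k : ℕ, u = F ^ k ∨ u = -F ^ k) {u : (ZMod m)ˣ}
    (hu : ht q c c' u * ht q c c' u = ht q c c' (u ^ 2)) : ht q c c' u * ht q c c' u⁻¹ = 1 := by
  have := hq.ht_sq_mul Q hF u u⁻¹
  rw [pow_two, mul_inv_cancel_right, ← pow_two, ← hu, mul_assoc] at this
  exact (left_eq_mul.1 this)

/-- From `ht u * ht u⁻¹ = 1` it follows that `Wt u` and `Wt 1` have the same square, whose inverse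
is `ht (-1)`; and `ht (-u)` is `(Wt u)⁻¹ * (Wt 1)⁻¹`. -/
lemma ht_neg {F : (ZMod m)ˣ} (hF : ∀ u, ∃ k : ℕ, u = F ^ k ∨ u = -F ^ k) {u : (ZMod m)ˣ}
    (hu : ht q c c' u * ht q c c' u = ht q c c' (u ^ 2)) :
    ht q c c' (-u) = ht q c c' (-1 : (ZMod m)ˣ) * ht q c c' u := by
  have h1 := hq.ht_mul_ht_inv Q hF hu
  have h2 := hq.conj_Wt_ht_one Q u
  rw [MulAut.conj_apply, mul_inv_eq_iff_eq_mul] at h2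
  have h3 : ht q c c' u * Wt q c c' (1 : (ZMod m)ˣ) = Wt q c c' u := by rw [ht]; group
  have h4 : Wt q c c' u * Wt q c c' u =
      Wt q c c' (1 : (ZMod m)ˣ) * Wt q c c' (1 : (ZMod m)ˣ) := by
    calc _ = ht q c c' u * (Wt q c c' (1 : (ZMod m)ˣ) * ht q c c' u) *
          Wt q c c' (1 : (ZMod m)ˣ) := by rw [← h3]; group
      _ = (ht q c c' u * ht q c c' u⁻¹) *
          (Wt q c c' (1 : (ZMod m)ˣ) * Wt q c c' (1 : (ZMod m)ˣ)) := by rw [h2]; group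
      _ = _ := by rw [h1, one_mul]
  have h5 : (Wt q c c' (1 : (ZMod m)ˣ))⁻¹ * (Wt q c c' (1 : (ZMod m)ˣ))⁻¹ =
      (Wt q c c' u)⁻¹ * (Wt q c c' u)⁻¹ := by
    rw [← _root_.mul_inv_rev, ← _root_.mul_inv_rev, h4]
  rw [hq.ht_neg_one, ht, ht, hq.Wt_neg, h5]
  group

lemma ht_neg_one_mul_self : ht q c c' (-1 : (ZMod m)ˣ) * ht q c c' (-1 : (ZMod m)ˣ) = 1 := by
  have := hq.Wt_one_pow_four Q
  rw [hq.ht_neg_one, ← _root_.mul_inv_rev, ← _root_.mul_inv_rev, this, inv_one]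

variable {F : (ZMod m)ˣ} (hF : ∀ u, ∃ k : ℕ, u = F ^ k ∨ u = -F ^ k) (hF5 : (F : ZMod m) = 5)
  [NeZero m] [IsLocalRing (ZMod m)]
include hF hF5

/-- Induction in steps of two: a factor `F ^ 2` splits off because it is a square, and `ht_five_sq`
evaluates it. -/
lemma ht_pow (k : ℕ) : ht q c c' (F ^ k) = ht q c c' F ^ k := by
  induction k using Nat.twoStepInduction with
  | zero => rw [pow_zero, pow_zero, ht_one]
  | one => rw [pow_one, pow_one]
  | more k ih _ =>
    rw [add_comm, _root_.pow_add, hq.ht_sq_mul Q hF, ih, ← hq.ht_five_sq Q.swap hF hF5,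
      _root_.pow_add, pow_two (ht q c c' F)]

theorem ht_mul (u v : (ZMod m)ˣ) : ht q c c' (u * v) = ht q c c' u * ht q c c' v := by
  have hp := hq.ht_pow Q hF hF5
  have hpp (k l : ℕ) : ht q c c' (F ^ k * F ^ l) = ht q c c' (F ^ k) * ht q c c' (F ^ l) := by
    rw [← _root_.pow_add, hp, hp, hp, _root_.pow_add]
  have hn (k : ℕ) : ht q c c' (-F ^ k) = ht q c c' (-1 : (ZMod m)ˣ) * ht q c c' (F ^ k) :=
    hq.ht_neg Q hF (by rw [← hpp, pow_two])
  have hc (k : ℕ) := (hq.ht_neg_one_commute Q (F ^ k)).eq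
  obtain ⟨k, rfl | rfl⟩ := hF u <;> obtain ⟨l, rfl | rfl⟩ := hF v
  · exact hpp k l
  · rw [mul_neg, ← _root_.pow_add, hn, hn, _root_.pow_add, hpp, ← mul_assoc, ← mul_assoc, hc k]
  · rw [neg_mul, ← _root_.pow_add, hn, hn, _root_.pow_add, hpp, ← mul_assoc]
  · rw [neg_mul_neg, hpp, hn, hn, hc k, mul_assoc, ← mul_assoc (ht q c c' (-1 : (ZMod m)ˣ)),
      hq.ht_neg_one_mul_self Q, one_mul]

theorem long_steinbergPair :
    SteinbergPair (fun t : ZMod m => tv q c t) (fun t => tv q c' (-t)) (ht q c c')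
      (Wt q c c' (1 : (ZMod m)ˣ)) where
  x_add s t := hq.tv_add c s t
  y_add s t := by rw [neg_add, hq.tv_add]
  h_mul u v := hq.ht_mul Q hF hF5 u v
  h_x u t := by rw [← mul_inv_eq_iff_eq_mul, ← MulAut.conj_apply, hq.conj_ht_tv Q]
  h_y u t := by rw [← mul_inv_eq_iff_eq_mul, ← MulAut.conj_apply, hq.conj_ht_tv' Q, mul_neg]
  w_x t := by rw [← mul_inv_eq_iff_eq_mul, ← MulAut.conj_apply, hq.conj_Wt_one_tv Q, neg_neg]
  w_y t := by rw [← mul_inv_eq_iff_eq_mul, ← MulAut.conj_apply, hq.conj_Wt_one_tv' Q]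
  w_unit u := by rw [neg_neg, ht, inv_mul_cancel_right, Wt]

omit Q c c' d d' in
theorem plane_eq_one (hg : 2 ≤ g) (i : Fin g) {A : SpecialLinearGroup (Fin 2) ℤ}
    (hA : SpecialLinearGroup.map (Int.castRingHom (ZMod m)) A = 1) : q (plane i A) = 1 := by
  have : Nontrivial (Fin g) := Fin.nontrivial_iff_two_le.2 hg
  obtain ⟨j, hj⟩ := exists_ne i
  have Q : SymplecticQuadruple (ev ℤ i) (fv ℤ i) (ev ℤ j) (fv ℤ j) :=
    ⟨sform_ev_fv i, sform_ev_fv j, sform_ev_ev i j, sform_ev_fv_ne hj.symm, sform_fv_ev_ne hj.symm,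
      sform_fv_fv i j⟩
  have P := hq.long_steinbergPair Q hF hF5
  set ρ := SpecialLinearGroup.map (n := Fin 2) (Int.castRingHom (ZMod m))
  -- The matrices for which the normal form of the reduction is equivariant. Quantifying over all
  -- `A` makes this a subgroup, so the generators of `SL₂(ℤ)` suffice; at `A = 1` it shows that `q
  -- (plane i B)` depends only on `B` modulo `m`.
  let H : Subgroup (SpecialLinearGroup (Fin 2) ℤ) :=
    { carrier := {B | ∀ A, P.normalForm (A * ρ B) = P.normalForm A * q (plane i B)}
      mul_mem' := fun {B C} hB hC A => by
        rw [map_mul, ← mul_assoc, hC, hB, plane_mul, map_mul, mul_assoc]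
      one_mem' := fun A => by rw [map_one, mul_one, plane_one, map_one, mul_one]
      inv_mem' := fun {B} hB A => by
        have h1 := hB (A * ρ B⁻¹)
        rw [map_inv, inv_mul_cancel_right] at h1
        have h2 : q (plane i B) * q (plane i B⁻¹) = 1 := by
          rw [← map_mul, ← plane_mul, mul_inv_cancel, plane_one, map_one]
        rw [map_inv, h1, mul_assoc, h2, mul_one] }
  have hT : upperE 1 ∈ H := fun A => by
    have e : ρ (upperE 1) = upperE 1 := by
      ext a b
      change (Int.castRingHom (ZMod m)) ((upperE 1).1 a b) = _
      fin_cases a <;> fin_cases b <;> simp [upperE]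
    rw [e, P.normalForm_mul_upperE_one, plane_upperE, hq.q_T, Int.cast_one]
  have hW : weylE ∈ H := fun A => by
    have e : ρ weylE = weylE := by
      ext a b
      change (Int.castRingHom (ZMod m)) (weylE.1 a b) = _
      fin_cases a <;> fin_cases b <;> simp [weylE]
    have e' : (weylE : SpecialLinearGroup (Fin 2) ℤ) = upperE 1 * lowerE (-1) * upperE 1 := by
      ext a b
      rw [Matrix.SpecialLinearGroup.coe_mul, Matrix.SpecialLinearGroup.coe_mul]
      fin_cases a <;> fin_cases b <;>
        simp [upperE, lowerE, weylE, Matrix.mul_apply, Fin.sum_univ_two]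
    rw [e]
    refine (P.normalForm_mul_weylE A).trans (congrArg _ ?_)
    rw [hq.Wt_one, e', plane_mul, plane_mul, plane_upperE, plane_lowerE, neg_neg]
  have hS : ModularGroup.S = (weylE : SpecialLinearGroup (Fin 2) ℤ)⁻¹ := by
    rw [eq_inv_iff_mul_eq_one]
    ext a b
    rw [Matrix.SpecialLinearGroup.coe_mul]
    fin_cases a <;> fin_cases b <;>
      simp [ModularGroup.S, weylE, Matrix.mul_apply, Fin.sum_univ_two]
  have htop : H = ⊤ := by
    rw [eq_top_iff, ← SpecialLinearGroup.SL2Z_generators, Subgroup.closure_le]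
    rintro B (rfl | rfl)
    · rw [hS]; exact H.inv_mem hW
    · exact hT
  have h1 : A ∈ H := htop ▸ Subgroup.mem_top A
  have h2 := h1 1
  rw [hA, mul_one, P.normalForm_one, one_mul] at h2
  exact h2.symm

end KillsLevel

/-! ### The level `2 ^ n` kernel as a commutator subgroup, and the conclusion -/

lemma vred_ev (m : ℕ) (i : Fin g) : vred m (ev ℤ i) = ev (ZMod m) i := by
  funext j
  by_cases hj : j = .inl i <;> simp [vred, ev, hj]

lemma vred_fv (m : ℕ) (i : Fin g) : vred m (fv ℤ i) = fv (ZMod m) i := by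
  funext j
  by_cases hj : j = .inr i <;> simp [vred, fv, hj]

lemma exists_eq_plane {l : Fin g} {A : Sp g ℤ} (hA : Fixes (Finset.univ.erase l) A) :
    ∃ B, A = plane l B := by
  have off (z : Fin g ⊕ Fin g → ℤ) (hz : ∀ i ≠ l, sform z (ev ℤ i) = 0 ∧ sform z (fv ℤ i) = 0) :
      z = z (.inl l) • ev ℤ l + z (.inr l) • fv ℤ l := by
    funext j
    rcases j with j | j
    · by_cases hj : j = l
      · subst hj; simp [ev, fv]
      · have := (hz j hj).2
        rw [sform_fv_right] at this
        simp [ev, fv, this, hj]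
    · by_cases hj : j = l
      · subst hj; simp [ev, fv]
      · have := (hz j hj).1
        rw [sform_ev_right] at this
        simp [ev, fv, neg_eq_zero.1 this, hj]
  have hf (i : Fin g) (hi : i ≠ l) := hA i (by simp [hi])
  have he : A • ev ℤ l = (A • ev ℤ l) (.inl l) • ev ℤ l + (A • ev ℤ l) (.inr l) • fv ℤ l := by
    refine off _ fun i hi => ⟨?_, ?_⟩
    · conv_lhs => rw [← (hf i hi).1]
      rw [sform_smul_smul, sform_ev_ev]
    · conv_lhs => rw [← (hf i hi).2]
      rw [sform_smul_smul, sform_ev_fv_ne hi.symm]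
  have hf' : A • fv ℤ l = (A • fv ℤ l) (.inl l) • ev ℤ l + (A • fv ℤ l) (.inr l) • fv ℤ l := by
    refine off _ fun i hi => ⟨?_, ?_⟩
    · conv_lhs => rw [← (hf i hi).1]
      rw [sform_smul_smul, sform_fv_ev_ne hi.symm]
    · conv_lhs => rw [← (hf i hi).2]
      rw [sform_smul_smul, sform_fv_fv]
  have hd := sform_smul_smul A (ev ℤ l) (fv ℤ l)
  generalize (A • ev ℤ l) (.inl l) = a at *
  generalize (A • ev ℤ l) (.inr l) = c at *
  generalize (A • fv ℤ l) (.inl l) = b at *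
  generalize (A • fv ℤ l) (.inr l) = d at *
  rw [he, hf'] at hd
  simp only [sform_add_left, sform_add_right, sform_smul_left, sform_smul_right, sform_ev_fv,
    sform_fv_ev, sform_ev_ev, sform_fv_fv] at hd
  let B : SpecialLinearGroup (Fin 2) ℤ :=
    ⟨!![a, b; c, d], by rw [det_fin_two_of]; linear_combination hd⟩
  refine ⟨B, ext_basis ?_ ?_⟩
  · intro i
    by_cases hi : i = l
    · subst hi; rw [plane_smul_ev, he]; rfl
    · rw [plane_smul_ev_ne (Ne.symm hi), (hf i hi).1]
  · intro i
    by_cases hi : i = l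
    · subst hi; rw [plane_smul_fv, hf']; rfl
    · rw [plane_smul_fv_ne (Ne.symm hi), (hf i hi).2]

lemma map_eq_one_of_reduce_plane {l : Fin g} {B : SpecialLinearGroup (Fin 2) ℤ}
    (hB : reduce g m (plane l B) = 1) :
    SpecialLinearGroup.map (Int.castRingHom (ZMod m)) B = 1 := by
  have h1 := reduce_smul_vred (plane l B) (ev ℤ l) (m := m)
  have h2 := reduce_smul_vred (plane l B) (fv ℤ l) (m := m)
  rw [hB, one_smul, plane_smul_ev] at h1
  rw [hB, one_smul, plane_smul_fv] at h2
  have e (x y : ℤ) : vred m (x • ev ℤ l + y • fv ℤ l) (.inl l) = x ∧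
      vred m (x • ev ℤ l + y • fv ℤ l) (.inr l) = y := by simp [vred, ev, fv]
  have a1 := congrFun h1 (.inl l)
  have a2 := congrFun h1 (.inr l)
  have a3 := congrFun h2 (.inl l)
  have a4 := congrFun h2 (.inr l)
  rw [(e _ _).1] at a1 a3
  rw [(e _ _).2] at a2 a4
  rw [vred_ev] at a1 a2
  rw [vred_fv] at a3 a4
  ext i j
  change ((B.1 i j : ℤ) : ZMod m) = _
  fin_cases i <;> fin_cases j
  · simpa [ev] using a1.symm
  · simpa [fv] using a3.symm
  · simpa [ev] using a2.symm
  · simpa [fv] using a4.symm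

/-- In the quotient by `[G, K]` the kernel `K` is central. The `m`-th powers of transvections then
lie in `[G, K]`, column reduction puts an element of `K` into one plane modulo `[G, K]`, and
`plane_eq_one` kills what is left. -/
theorem ker_reduce_le_commutator {n : ℕ} (hn : n ≠ 0) (hg : 2 ≤ g) :
    (reduce g (2 ^ n)).ker ≤ ⁅(⊤ : Subgroup (Sp g ℤ)), (reduce g (2 ^ n)).ker⁆ := by
  set m := 2 ^ n with hm
  set K := (reduce g m).ker
  set N := ⁅(⊤ : Subgroup (Sp g ℤ)), K⁆
  set q := QuotientGroup.mk' N
  have hNK : N ≤ K := Subgroup.commutator_le_right _ _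
  have hloc : IsLocalRing (ZMod m) := ZMod.isLocalRing_two_pow hn
  have hm2 : Even m := (Nat.even_pow.2 ⟨even_two, hn⟩)
  have hm0 : NeZero m := ⟨by positivity⟩
  have hc : CentralMod m q := fun A hA B => by
    rw [Commute, SemiconjBy, ← commutatorElement_eq_one_iff_mul_comm, ← map_commutatorElement,
      ← _root_.inv_inj, inv_one, ← map_inv, commutatorElement_inv]
    exact (QuotientGroup.eq_one_iff _).2
      (Subgroup.commutator_mem_commutator (Subgroup.mem_top _) (MonoidHom.mem_ker.2 hA))
  have hT := hc.T_eq_one hm2 hg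
  have hq : KillsLevel m q := ⟨hc, hT⟩
  intro A hA
  let l : Fin g := ⟨0, by omega⟩
  obtain ⟨h, hh, hF⟩ := exists_fixes_compl (fun v => (QuotientGroup.eq_one_iff _).1 (hT v)) hNK hm2
    hm0.out (MonoidHom.mem_ker.1 hA) l _ (Finset.notMem_erase _ Finset.univ)
  obtain ⟨B, hB⟩ := exists_eq_plane hF
  have h1 : reduce g m (plane l B) = 1 := by
    rw [← hB]
    exact MonoidHom.mem_ker.1 (K.mul_mem (hNK hh) hA)
  have h2 := hq.plane_eq_one (ZMod.exists_eq_five_pow n) (ZMod.coe_five n) hg l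
    (map_eq_one_of_reduce_plane h1)
  rw [← hB] at h2
  have h3 := (QuotientGroup.eq_one_iff _).1 h2
  exact (N.mul_mem_cancel_left hh).1 h3

/-- Transvections generate over the local ring `ℤ/2 ^ n`, and each lifts to an integral transvection
by lifting its vector and its parameter. -/
theorem reduce_surjective {n : ℕ} (hn : n ≠ 0) : Function.Surjective (reduce g (2 ^ n)) := by
  have hloc : IsLocalRing (ZMod (2 ^ n)) := ZMod.isLocalRing_two_pow hn
  rw [← MonoidHom.range_eq_top]
  refine eq_top_of_transvections_mem _ fun v k => ?_
  have hv : (fun i => (((v i).cast : ℤ) : ZMod (2 ^ n))) = v := by funext i; simp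
  refine ⟨T (fun i => ((v i).cast : ℤ)) (k.cast : ℤ), ?_⟩
  rw [reduce_T, hv]
  simp

lemma reduceZMod_comp_reduce {m M : ℕ} (h : m ∣ M) :
    (reduceZMod g h).comp (reduce g M) = reduce g m := by
  ext A i j
  change ZMod.castHom h (ZMod m) ((A.1 i j : ℤ) : ZMod M) = ((A.1 i j : ℤ) : ZMod m)
  simp

end Sp

theorem mainTheorem5 (n g : ℕ) (hn : 1 ≤ n) (hg : 2 ≤ g) :
    Function.Surjective (integralHomologyMap (Sp.reduce g (2 ^ n)) 2) ∧
    Function.Surjective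
      (integralHomologyMap
        (Sp.reduceZMod g (pow_dvd_pow 2 n.le_succ : 2 ^ n ∣ 2 ^ (n + 1))) 2) := by
  have hn' : n ≠ 0 := Nat.one_le_iff_ne_zero.1 hn
  have h1 := integralHomologyMap_two_surjective (Sp.ker_reduce_le_commutator hn' hg)
    (Sp.reduce_surjective hn')
  -- The map in (i) factors through the map in (ii), so surjectivity passes to the latter.
  refine ⟨h1, Function.Surjective.of_comp
    (g := integralHomologyMap (Sp.reduce g (2 ^ (n + 1))) 2) ?_⟩
  rw [← LinearMap.coe_comp, ← integralHomologyMap_comp, Sp.reduceZMod_comp_reduce]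
  exact h1
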